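/- **Theorem 2.** Let $M$ be a smooth manifold of dimension $n\ge 3$ with a Finsler metric $F$, i.e. a continuous function $F\colon TM\to\mathbb R$, smooth off the zero section, with $F(tv)=tF(v)$ for $t>0$, such that the Hessian $g_{ij}=\partial^2E/\partial y^i\partial y^j$ of the energy $E=\tfrac12F^2$ is positive definite at all nonzero tangent vectors; here $(x^i,y^i)$ are the coordinates on $TM$ induced by local coordinates $u^i$ around a point $p\in M$. Let $\alpha\colon M\to\mathbb R$ be a smooth function with $d_p\alpha\ne0$, and put $\alpha_l=\partial\alpha/\partial u^l$ and $(g^{ij})=(g_{ij})^{-1}$. Let $$G^l=\tfrac12 g^{lm}\Big(y^k\frac{\partial^2E}{\partial y^m\partial x^k}-\frac{\partial E}{\partial x^m}\Big),\qquad P^l_{ijk}=-\frac{\partial^3G^l}{\partial y^i\partial y^j\partial y^k}$$ be the spray coefficients and the mixed curvature of the Berwald connection of $F$, and let $\tilde P^l_{ijk}$ be the mixed curvature of $\tilde F=e^{\alpha}F$. Suppose that - the indicatrix hypersurface $\{v\in T_pM: 2E(v)=F(v)^2=1\}$, with the Riemannian metric induced by $g_{ij}$, has positive sectional curvature, and -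 $\tilde P^l_{ijk}\alpha_l=P^l_{ijk}\alpha_l$ for all $i,j,k$ at all nonzero $v\in T_pM$. Let $X^l=g^{lm}\alpha_m$ be the Riemann–Finsler gradient and $E_*=E\,X^l\alpha_l$ on $T_pM$ (with $E_*(0)=0$). Then: 1. $E_*$ is a positive definite quadratic form on $T_pM$; hence $g^*_{ij}=\partial^2E_*/\partial y^i\partial y^j$ is constant and invertible on $T_pM\setminus\{0\}$, and the Riemannian gradient $X_*^l=g_*^{lk}\alpha_k$, where $(g_*^{ij})=(g^*_{ij})^{-1}$, is one vector $X_*(p)\in T_pM$, independent of $v$. 2. At every nonzero $v\in T_pM$ the vectors $X=X^l\frac{\partial}{\partial y^l}$, $X_*=X_*^l\frac{\partial}{\partial y^l}$ and the Liouville vector $C=y^l\frac{\partial}{\partial y^l}$ are linearly dependent, i.e. their Gram determinant with respect to $g_{ij}$ vanishes. 3. Let $v\in T_pM$ with $d_p\alpha(v)=0$, and put $c(t)=v+tX_*(p)$, $a^2=2E_*(v)$, $b^2=2E_*(X_*(p))$, $y=E\circ c$ and $z=y'/y$. For every $t$ if $v\neq 0$, and for every $t\ne0$ if $v=0$, one has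 $c(t)\neq0$ and $y(t)>0$, $y$ is of class $C^2$ near $t$, $z$ is differentiable at $t$, and $$0=\big(a^2+t^2b^2(1-b^2)\big)\,y\,y''-\tfrac12(a^2+t^2b^2)(y')^2+2tb^4\,y\,y'-2b^4y^2,$$ $$0=\big(a^2+t^2b^2(1-b^2)\big)\,z'+\tfrac12\big(a^2+t^2b^2(1-2b^2)\big)z^2+2tb^4z-2b^4 .$$ -/

import Mathlib

open scoped Manifold ContDiff

noncomputable section

namespace FinslerConformal

/-- The coordinate space `ℝⁿ`. -/
abbrev Vec (n : ℕ) : Type := EuclideanSpace ℝ (Fin n)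

/-- The partial derivative `∂f/∂zⁱ`. -/
def pd {n : ℕ} (i : Fin n) (f : Vec n → ℝ) (z : Vec n) : ℝ :=
  fderiv ℝ f z (EuclideanSpace.single i 1)

/-! ### Sectional curvature of a Riemannian metric given in coordinates -/

section Riemannian

variable {m : ℕ}

/-- Christoffel symbols `Γᵏᵢⱼ = ½ hᵏˡ (∂ᵢ hⱼₗ + ∂ⱼ hᵢₗ - ∂ₗ hᵢⱼ)`. -/
def christoffel (h : Vec m → Matrix (Fin m) (Fin m) ℝ) (k i j : Fin m) (s : Vec m) : ℝ :=
  (1 / 2) * ∑ l, (h s)⁻¹ k l *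
    (pd i (fun s' => h s' j l) s + pd j (fun s' => h s' i l) s - pd l (fun s' => h s' i j) s)

/-- Riemann curvature components, `R(∂ᵢ, ∂ⱼ) ∂ₖ = Rˡₖᵢⱼ ∂ₗ` with
`R(U, V) = ∇_U ∇_V - ∇_V ∇_U - ∇_[U,V]`. -/
def riemann (h : Vec m → Matrix (Fin m) (Fin m) ℝ) (l k i j : Fin m) (s : Vec m) : ℝ :=
  pd i (christoffel h l j k) s - pd j (christoffel h l i k) s
    + ∑ r, (christoffel h l i r s * christoffel h r j k s
          - christoffel h l j r s * christoffel h r i k s)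

/-- The sectional curvature `h(R(u, w) w, u) / (h(u,u) h(w,w) - h(u,w)²)` at `s`. -/
def sectionalCurvature (h : Vec m → Matrix (Fin m) (Fin m) ℝ) (s u w : Vec m) : ℝ :=
  (∑ a, ∑ l, ∑ k, ∑ i, ∑ j, h s a l * riemann h l k i j s * u i * w j * w k * u a) /
    ((∑ a, ∑ b, h s a b * u a * u b) * (∑ a, ∑ b, h s a b * w a * w b)
      - (∑ a, ∑ b, h s a b * u a * w b) ^ 2)

end Riemannian

/-! ### Quantities in a single tangent space, in linear coordinates `y`

`L` is the energy `y ↦ E(y)` of the tangent space and `a = (αₗ)` are the components of a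
covector. -/

section Fibre

variable {n : ℕ}

/-- The Hessian `∂²L/∂yⁱ∂yʲ`; for `L = E` this is the Riemann-Finsler metric `gᵢⱼ`. -/
def hess (L : Vec n → ℝ) (y : Vec n) : Matrix (Fin n) (Fin n) ℝ :=
  Matrix.of fun i j => pd j (pd i L) y

/-- The gradient `gˡᵐ aₘ` of the covector `a` with respect to `gᵢⱼ = ∂²L/∂yⁱ∂yʲ`. -/
def grad (L : Vec n → ℝ) (a : Fin n → ℝ) (y : Vec n) : Vec n :=
  WithLp.toLp 2 (Matrix.mulVec (hess L y)⁻¹ a)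

/-- The associated energy `E_* = E · Xˡ aₗ`, where `Xˡ = gˡᵐ aₘ`. -/
def energyStar (L : Vec n → ℝ) (a : Fin n → ℝ) (y : Vec n) : ℝ :=
  L y * ∑ l, grad L a y l * a l

/-- The gradient `X_*ˡ = g_*ˡᵏ aₖ` of `a` with respect to the Hessian `g*` of `E_*`. -/
def gradStar (L : Vec n → ℝ) (a : Fin n → ℝ) (y : Vec n) : Vec n :=
  grad (energyStar L a) a y

/-- The Gram determinant of three vectors with respect to the metric `gᵢⱼ` at `y`. -/
def gramDet (L : Vec n → ℝ) (y : Vec n) (u : Fin 3 → Vec n) : ℝ :=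
  Matrix.det (Matrix.of fun r s : Fin 3 => ∑ i, ∑ j, hess L y i j * u r i * u s j)

/-- A local parametrization, over an open set `U`, of the indicatrix hypersurface
`{y | 2 E(y) = 1}`: a smooth immersion of `U` with values in the indicatrix. -/
structure IsIndicatrixParam (L : Vec n → ℝ) (U : Set (Vec (n - 1)))
    (φ : Vec (n - 1) → Vec n) : Prop where
  isOpen : IsOpen U
  smooth : ContDiffOn ℝ ∞ φ U
  immersion : ∀ s ∈ U, Function.Injective (fderiv ℝ φ s)
  mem : ∀ s ∈ U, 2 * L (φ s) = 1

/-- The metric induced by `gᵢⱼ` on a parametrized hypersurface. -/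
def inducedMetric (L : Vec n → ℝ) (φ : Vec (n - 1) → Vec n) (s : Vec (n - 1)) :
    Matrix (Fin (n - 1)) (Fin (n - 1)) ℝ :=
  Matrix.of fun a b => ∑ i, ∑ j, hess L (φ s) i j *
    fderiv ℝ φ s (EuclideanSpace.single a 1) i * fderiv ℝ φ s (EuclideanSpace.single b 1) j

/-- All sectional curvatures of the indicatrix hypersurface, with the metric induced by
`gᵢⱼ`, are positive. -/
def IndicatrixPositivelyCurved (L : Vec n → ℝ) : Prop :=
  ∀ (U : Set (Vec (n - 1))) (φ : Vec (n - 1) → Vec n), IsIndicatrixParam L U φ →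
    ∀ s ∈ U, ∀ u w : Vec (n - 1), LinearIndependent ℝ ![u, w] →
      0 < sectionalCurvature (inducedMetric L φ) s u w

end Fibre

/-! ### Spray and Berwald curvature in induced coordinates `(x, y)`; `L x y` is the energy -/

section Spray

variable {n : ℕ}

/-- The geodesic spray coefficients
`Gˡ = ½ gˡᵐ (yᵏ ∂²E/∂yᵐ∂xᵏ - ∂E/∂xᵐ)`. -/
def spray (L : Vec n → Vec n → ℝ) (l : Fin n) (x y : Vec n) : ℝ :=
  (1 / 2) * ∑ m, (hess (L x) y)⁻¹ l m *
    ((∑ k, y k * pd k (fun x' => pd m (L x') y) x) - pd m (fun x' => L x' y) x)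

/-- The mixed curvature `Pˡᵢⱼₖ = -∂³Gˡ/∂yⁱ∂yʲ∂yᵏ` of the Berwald connection. -/
def berwaldMixed (L : Vec n → Vec n → ℝ) (l i j k : Fin n) (x y : Vec n) : ℝ :=
  - pd k (pd j (pd i (spray L l x))) y

end Spray

/-! ### Finsler metrics on manifolds -/

section Manifold

variable {n : ℕ} {M : Type*} [TopologicalSpace M] [ChartedSpace (Vec n) M]
  [IsManifold (𝓡 n) ∞ M]

/-- The energy `E = ½ F²`. -/
def energy (F : TangentBundle (𝓡 n) M → ℝ) (v : TangentBundle (𝓡 n) M) : ℝ :=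
  (1 / 2) * F v ^ 2

/-- Finsler metrics: continuous, smooth off the zero section, positively homogeneous, and
strongly convex. The tangent space at `q` is, as a vector space, `ℝⁿ`, so the second derivative
of the energy along it makes sense. -/
structure IsFinslerMetric (F : TangentBundle (𝓡 n) M → ℝ) : Prop where
  continuous : Continuous F
  smooth : ContMDiffOn (𝓡 n).tangent 𝓘(ℝ, ℝ) ∞ F {v | v.2 ≠ 0}
  homogeneous : ∀ (q : M) (v : TangentSpace (𝓡 n) q) (t : ℝ), 0 < t →
    F ⟨q, t • v⟩ = t * F ⟨q, v⟩
  convex : ∀ (q : M) (v w : Vec n), v ≠ 0 → w ≠ 0 →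
    0 < fderiv ℝ (fderiv ℝ fun y : Vec n => energy F ⟨q, y⟩) v w w

/-- The conformal change `e^α F`. -/
def conformalChange (α : M → ℝ) (F : TangentBundle (𝓡 n) M → ℝ)
    (v : TangentBundle (𝓡 n) M) : ℝ :=
  Real.exp (α v.1) * F v

/-- The energy in the coordinates `(x, y)` of the tangent bundle induced by a chart `e`:
`(x, y)` stands for the tangent vector `yⁱ ∂/∂uⁱ` at the point with coordinates `x`. -/
def coordEnergy (e : OpenPartialHomeomorph M (Vec n)) (F : TangentBundle (𝓡 n) M → ℝ)
    (x y : Vec n) : ℝ :=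
  energy F ⟨e.symm x, mfderiv (𝓡 n) (𝓡 n) e.symm x y⟩

/-- The coordinates `(yⁱ(v))` of a tangent vector `v` at `p`. -/
def tangentCoord (e : OpenPartialHomeomorph M (Vec n)) (p : M) (v : TangentSpace (𝓡 n) p) :
    Vec n :=
  mfderiv (𝓡 n) (𝓡 n) e p v

/-- The partial derivatives `αₗ = ∂α/∂uˡ` at the point `p`. -/
def coordDeriv (e : OpenPartialHomeomorph M (Vec n)) (α : M → ℝ) (p : M) (l : Fin n) : ℝ :=
  pd l (fun x => α (e.symm x)) (e p)

end Manifold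

end FinslerConformal

end

open FinslerConformal

/-!
# Rigidity of the conformal change with invariant contracted mixed curvature

In a tangent space, `L` is the energy, `X` the gradient of the covector `α` with respect to the
Hessian `g` of `L`, and `E_* = L · α(X)`. The difference of the spray coefficients of `e^α F` and `F`
is `α(y) yˡ - L Xˡ`, so the invariance of the contracted mixed curvature says that the third
derivatives of `E_*` vanish off the origin, and `E_* = ½ B` for a positive definite form `B`.
Let `Xs` be the `B`-gradient of `α`.

* Comparing `B` and `g` at the extrema of `α(X) = ½ B / L` gives `α(Xs) = 1`.
* The Wronskian of `L` and `½ B` along a line `v + t Xs` is then nonincreasing in `t`; its limits at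
  `±∞` exist and are odd in `v`. Hence it is constant, `α(X)` is monotone along each line, in
  opposite senses along the lines through `v` and `-v`, and therefore constant.

So `L` is a constant multiple of `E_*`, and the remaining assertions are read off from this. The
argument does not need the positivity of the curvature of the indicatrix.
-/

/-! Write `g` for the Hessian of `L`, `C` for its third derivative and `ρ = α(X) = ½ B / L`, a
function constant on rays. Contracting the spray difference `α(y) yˡ - L Xˡ` (`spray_conformal`)
with `α` gives `α(y)² - E_*`. Equal contracted curvatures therefore kill its third derivatives
(`pd_pd_pd_energyStar`), and on the connected set of nonzero vectors this makes it, hence `E_* = ½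
B`, quadratic (`exists_form_of_pd_pd_pd_eq_zero`). The heart is that `ρ` is then constant
(`apply_grad_eq_const`).

Cauchy–Schwarz for `g` gives `α(Xs)² ≤ ρ g(Xs, Xs)`. At a minimum of `ρ` one has `ρ g ≤ B`, at a
maximum the reverse, and together with Cauchy–Schwarz for `g` and for `B` this forces `α(Xs) = 1`
(`apply_gradStar_eq_one`). Along `v + t Xs` the derivative of `ρ` is `W / L²`, with Wronskian
derivative `W' = L (1 - ρ g(Xs, Xs)) ≤ 0`. For large `t`, rescaling moves the point to `Xs`; as `C`
annihilates radial vectors and `X(Xs)` is radial, `W` tends to a cubic expression in `v`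
(`tendsto_wronskian`). Cubics are odd, so the decrease of `W` along the lines of both `v` and `-v`
is possible only if `W` is constant (`exists_wronskian_eq`). Then `ρ` runs monotonically between its
values at `-Xs` and `Xs`, upwards on one line and downwards on the other, so it is constant.

Hence `L = c⁻¹ E_*`, `X = c Xs`, `b² = 1` and `y = (a² + t²) / (2c)`, from which dependence and both
equations follow. -/

namespace FinslerConformal

open Filter Topology

/-! ### Homogeneity, convexity and calculus along lines -/

section Core

variable {V : Type*} [NormedAddCommGroup V] [NormedSpace ℝ V]

/-- A positively 2-homogeneous function `L`, of class `C³` off the origin. -/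
structure IsTwoHomogeneous (L : V → ℝ) : Prop where
  contDiffAt : ∀ y, y ≠ 0 → ContDiffAt ℝ 3 L y
  smul : ∀ (y : V) (t : ℝ), 0 < t → L (t • y) = t ^ 2 * L y

/-- A positively 2-homogeneous, strongly convex function. -/
structure IsMinkowskiEnergy (L : V → ℝ) : Prop extends IsTwoHomogeneous L where
  convex : ∀ y w : V, y ≠ 0 → w ≠ 0 → 0 < fderiv ℝ (fderiv ℝ L) y w w

namespace IsTwoHomogeneous

variable {L : V → ℝ} (h : IsTwoHomogeneous L) {y : V}
include h

lemma map_zero : L 0 = 0 := by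
  have := h.smul 0 2 (by norm_num)
  rw [smul_zero] at this
  linarith

lemma differentiableAt (hy : y ≠ 0) : DifferentiableAt ℝ L y :=
  (h.contDiffAt y hy).differentiableAt (by norm_num)

lemma contDiffAt_fderiv (hy : y ≠ 0) : ContDiffAt ℝ 2 (fderiv ℝ L) y :=
  (h.contDiffAt y hy).fderiv_right (by norm_num)

lemma differentiableAt_fderiv (hy : y ≠ 0) : DifferentiableAt ℝ (fderiv ℝ L) y :=
  (h.contDiffAt_fderiv hy).differentiableAt (by norm_num)

lemma contDiffAt_hessian (hy : y ≠ 0) : ContDiffAt ℝ 1 (fderiv ℝ (fderiv ℝ L)) y :=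
  (h.contDiffAt_fderiv hy).fderiv_right (by norm_num)

lemma differentiableAt_hessian (hy : y ≠ 0) : DifferentiableAt ℝ (fderiv ℝ (fderiv ℝ L)) y :=
  (h.contDiffAt_hessian hy).differentiableAt (by norm_num)

lemma hessian_comm (hy : y ≠ 0) (u w : V) :
    fderiv ℝ (fderiv ℝ L) y u w = fderiv ℝ (fderiv ℝ L) y w u :=
  ((h.contDiffAt y hy).isSymmSndFDerivAt (by simp; norm_num)) u w

lemma fderiv_self (hy : y ≠ 0) : fderiv ℝ L y y = 2 * L y := by
  have h1 : HasDerivAt (fun t : ℝ => L (t • y)) (fderiv ℝ L y y) 1 := by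
    have h2 : HasFDerivAt L (fderiv ℝ L y) ((1 : ℝ) • y) := by
      rw [one_smul]; exact (h.differentiableAt hy).hasFDerivAt
    have h3 : HasDerivAt (fun t : ℝ => t • y) y 1 := by
      simpa using (hasDerivAt_id (1 : ℝ)).smul_const y
    exact h2.comp_hasDerivAt (1 : ℝ) h3
  have h4 : HasDerivAt (fun t : ℝ => t ^ 2 * L y) (2 * L y) 1 := by
    simpa using (hasDerivAt_pow 2 (1 : ℝ)).mul_const (L y)
  refine h1.unique (h4.congr_of_eventuallyEq ?_)
  filter_upwards [lt_mem_nhds (zero_lt_one' ℝ)] with t ht using h.smul y t ht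

lemma fderiv_smul {t : ℝ} (ht : 0 < t) : fderiv ℝ L (t • y) = t • fderiv ℝ L y := by
  have h1 : (fun z => L (t • z)) = fun z => t ^ 2 * L z := funext fun z => h.smul z t ht
  have h2 := fderiv_comp_smul (𝕜 := ℝ) (f := L) t (x := y)
  rw [h1] at h2
  have h3 : fderiv ℝ (fun z => t ^ 2 * L z) y = t ^ 2 • fderiv ℝ L y :=
    congrFun (fderiv_const_smul_field (𝕜 := ℝ) (f := L) (t ^ 2)) y
  rw [h3] at h2
  have h4 : t • (t • fderiv ℝ L y) = t • fderiv ℝ L (t • y) := by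
    rw [← h2, smul_smul, sq]
  exact (smul_right_injective _ ht.ne' h4).symm

lemma hessian_self_right (hy : y ≠ 0) (w : V) :
    fderiv ℝ (fderiv ℝ L) y w y = fderiv ℝ L y w := by
  have h1 : HasFDerivAt (fun z => fderiv ℝ L z z)
      ((fderiv ℝ L y).comp (ContinuousLinearMap.id ℝ V) + (fderiv ℝ (fderiv ℝ L) y).flip y) y :=
    (h.differentiableAt_fderiv hy).hasFDerivAt.clm_apply (hasFDerivAt_id y)
  have h2 : HasFDerivAt (fun z => 2 * L z) ((2 : ℝ) • fderiv ℝ L y) y :=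
    (h.differentiableAt hy).hasFDerivAt.const_mul 2
  have h3 := h1.unique (h2.congr_of_eventuallyEq (by
    filter_upwards [isOpen_ne.mem_nhds hy] with z hz using h.fderiv_self hz))
  have h4 := congrArg (fun T : V →L[ℝ] ℝ => T w) h3
  simp at h4
  linarith

lemma hessian_self_left (hy : y ≠ 0) (w : V) :
    fderiv ℝ (fderiv ℝ L) y y w = fderiv ℝ L y w := by
  rw [h.hessian_comm hy, h.hessian_self_right hy]

lemma fderiv_hessian_comm (hy : y ≠ 0) (v u w : V) :
    fderiv ℝ (fderiv ℝ (fderiv ℝ L)) y v u w = fderiv ℝ (fderiv ℝ (fderiv ℝ L)) y v w u := by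
  have hd := (h.differentiableAt_hessian hy).hasFDerivAt
  have h1 := (hd.clm_apply (hasFDerivAt_const u y)).clm_apply (hasFDerivAt_const w y)
  have h2 := (hd.clm_apply (hasFDerivAt_const w y)).clm_apply (hasFDerivAt_const u y)
  have h3 := h1.unique (h2.congr_of_eventuallyEq (by
    filter_upwards [isOpen_ne.mem_nhds hy] with z hz using h.hessian_comm hz u w))
  simpa using congrArg (fun T : V →L[ℝ] ℝ => T v) h3

/-- Differentiating `g_y(y, w) = dL_y(w)` in the direction `v` produces `g(v, w)` on both sides, so
the third derivative annihilates radial vectors. -/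
lemma fderiv_hessian_self (hy : y ≠ 0) (v w : V) :
    fderiv ℝ (fderiv ℝ (fderiv ℝ L)) y v y w = 0 := by
  have hd := (h.differentiableAt_hessian hy).hasFDerivAt
  have h1 := (hd.clm_apply (hasFDerivAt_id y)).clm_apply (hasFDerivAt_const w y)
  have h2 := (h.differentiableAt_fderiv hy).hasFDerivAt.clm_apply (hasFDerivAt_const w y)
  have h3 := h1.unique (h2.congr_of_eventuallyEq (by
    filter_upwards [isOpen_ne.mem_nhds hy] with z hz using h.hessian_self_left hz w))
  simpa using congrArg (fun T : V →L[ℝ] ℝ => T v) h3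

lemma fderiv_hessian_add_smul (hy : y ≠ 0) (v σ : V) (r : ℝ) :
    fderiv ℝ (fderiv ℝ (fderiv ℝ L)) y v (σ + r • y) (σ + r • y) =
      fderiv ℝ (fderiv ℝ (fderiv ℝ L)) y v σ σ := by
  simp [h.fderiv_hessian_self hy, h.fderiv_hessian_comm hy v σ y]

end IsTwoHomogeneous

namespace IsMinkowskiEnergy

variable {L : V → ℝ} (h : IsMinkowskiEnergy L) {y : V}
include h

lemma pos (hy : y ≠ 0) : 0 < L y := by
  have := h.convex y y hy hy
  rw [h.hessian_self_left hy, h.fderiv_self hy] at this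
  linarith

lemma hessian_cauchySchwarz (hy : y ≠ 0) (u w : V) :
    fderiv ℝ (fderiv ℝ L) y u w ^ 2 ≤
      fderiv ℝ (fderiv ℝ L) y u u * fderiv ℝ (fderiv ℝ L) y w w := by
  rcases eq_or_ne w 0 with rfl | hw
  · simp
  set G := fderiv ℝ (fderiv ℝ L) y
  have hww : 0 < G w w := h.convex y w hy hw
  -- The vector is the part of `u` orthogonal to `w`, scaled by `G w w` to avoid division.
  have key : 0 ≤ G (G w w • u - G u w • w) (G w w • u - G u w • w) := by
    rcases eq_or_ne (G w w • u - G u w • w) 0 with h0 | h0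
    · simp [h0]
    · exact (h.convex y _ hy h0).le
  have hc : G w u = G u w := h.hessian_comm hy w u
  simp only [map_sub, map_smul, sub_apply, smul_apply, smul_eq_mul, hc] at key
  have : 0 ≤ G w w * (G u u * G w w - G u w ^ 2) := by nlinarith
  have := nonneg_of_mul_nonneg_right this hww
  linarith

end IsMinkowskiEnergy

/-- The second derivative is nonnegative at a local minimum. -/
lemma secondDeriv_nonneg_of_isLocalMin {φ φ' : ℝ → ℝ} {d : ℝ} {x : ℝ} (hmin : IsLocalMin φ x)
    (h1 : ∀ᶠ t in 𝓝 x, HasDerivAt φ (φ' t) t) (h2 : HasDerivAt φ' d x) : 0 ≤ d := by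
  by_contra! hd
  have he : deriv φ =ᶠ[𝓝 x] φ' := h1.mono fun t ht => ht.deriv
  have hdd : deriv (deriv φ) x = d := by rw [he.deriv_eq, h2.deriv]
  -- A negative `d` would make the minimum also a maximum, so `φ` would be locally constant and `d`
  -- zero.
  have hmax : IsLocalMax φ x := isLocalMax_of_deriv_deriv_neg (by rw [hdd]; exact hd)
    hmin.deriv_eq_zero h1.self_of_nhds.continuousAt
  have hconst : φ =ᶠ[𝓝 x] fun _ => φ x := by
    filter_upwards [hmin, hmax] with t h3 h4 using le_antisymm h4 h3
  have h5 : deriv φ =ᶠ[𝓝 x] fun _ => 0 := by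
    filter_upwards [hconst.deriv] with t ht
    rw [ht]; simp
  have := h5.deriv_eq
  simp [hdd] at this
  exact hd.ne this

lemma hasDerivAt_line {E : Type*} [NormedAddCommGroup E] [NormedSpace ℝ E] {f : V → E} {v w : V}
    {t : ℝ} (hf : DifferentiableAt ℝ f (v + t • w)) :
    HasDerivAt (fun s : ℝ => f (v + s • w)) (fderiv ℝ f (v + t • w) w) t := by
  have h3 : HasDerivAt (fun s : ℝ => v + s • w) w t := by
    simpa using ((hasDerivAt_id t).smul_const w).const_add v
  exact hf.hasFDerivAt.comp_hasDerivAt t h3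

lemma hasDerivAt_form_line {B : V →L[ℝ] V →L[ℝ] ℝ} (hB : ∀ u w, B u w = B w u) (v w : V) (t : ℝ) :
    HasDerivAt (fun s : ℝ => B (v + s • w) (v + s • w)) (2 * B (v + t • w) w) t := by
  have h1 : HasDerivAt (fun s : ℝ => B v v + s * (2 * B v w) + s ^ 2 * B w w)
      (1 * (2 * B v w) + (2 : ℕ) * t ^ (2 - 1) * B w w) t :=
    (((hasDerivAt_id t).mul_const _).const_add _).add ((hasDerivAt_pow 2 t).mul_const _)
  convert h1 using 1
  · ext s
    simp [hB w v]; ring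
  · simp; ring

end Core

/-! ### Rigidity: extrema of `α(X)` and its derivative -/

section Rigidity

variable {V : Type*} [NormedAddCommGroup V] [NormedSpace ℝ V]

/-- `L` is an energy function, `X` the gradient of the covector `α` with respect to the Hessian of
`L`, the function `L · α(X)` is the quadratic form `½ B`, and `Xs` is the gradient of `α` with
respect to `B`. -/
structure HasQuadraticStar (L : V → ℝ) (α : V →L[ℝ] ℝ) (X : V → V) (B : V →L[ℝ] V →L[ℝ] ℝ)
    (Xs : V) : Prop extends IsMinkowskiEnergy L where
  differentiableAt_grad : ∀ y, y ≠ 0 → DifferentiableAt ℝ X y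
  hessian_grad : ∀ y u, y ≠ 0 → fderiv ℝ (fderiv ℝ L) y (X y) u = α u
  form_comm : ∀ u w, B u w = B w u
  form_pos : ∀ u, u ≠ 0 → 0 < B u u
  star_eq : ∀ y, y ≠ 0 → L y * α (X y) = 1 / 2 * B y y
  form_gradStar : ∀ w, B Xs w = α w
  ne_zero : α ≠ 0

namespace HasQuadraticStar

variable {L : V → ℝ} {α : V →L[ℝ] ℝ} {X : V → V} {B : V →L[ℝ] V →L[ℝ] ℝ} {Xs : V}
  (h : HasQuadraticStar L α X B Xs) {y : V}
include h

/-- This symmetry preserves `α(X)` and reverses `Xs`, so each result about `t → ∞` also yields one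
about `t → -∞`. -/
lemma neg : HasQuadraticStar L (-α) (fun y => -X y) B (-Xs) where
  toIsMinkowskiEnergy := h.toIsMinkowskiEnergy
  differentiableAt_grad y hy := (h.differentiableAt_grad y hy).neg
  hessian_grad y u hy := by simp [h.hessian_grad y u hy]
  form_comm := h.form_comm
  form_pos := h.form_pos
  star_eq y hy := by simpa using h.star_eq y hy
  form_gradStar w := by simp [h.form_gradStar w]
  ne_zero := neg_ne_zero.2 h.ne_zero

lemma gradStar_ne_zero : Xs ≠ 0 := by
  rintro rfl
  exact h.ne_zero (ContinuousLinearMap.ext fun w => by simpa using (h.form_gradStar w).symm)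

lemma apply_grad_eq (hy : y ≠ 0) : α (X y) = 1 / 2 * B y y / L y := by
  rw [eq_div_iff (h.pos hy).ne', ← h.star_eq y hy, mul_comm]

lemma apply_grad_pos (hy : y ≠ 0) : 0 < α (X y) := by
  rw [h.apply_grad_eq hy]
  have := h.form_pos y hy
  have := h.pos hy
  positivity

lemma apply_grad_smul (hy : y ≠ 0) {t : ℝ} (ht : 0 < t) : α (X (t • y)) = α (X y) := by
  rw [h.apply_grad_eq hy, h.apply_grad_eq (smul_ne_zero ht.ne' hy), h.smul y t ht]
  have := (h.pos hy).ne'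
  simp only [map_smul, smul_apply, smul_eq_mul]
  field_simp

/-- The comparison of `B` with the Hessian at an extremum of the quotient `½ B / L`; the sign `ε`
distinguishes minima and maxima. -/
lemma form_comparison {y₀ : V} (hy₀ : y₀ ≠ 0) {ε : ℝ}
    (hext : ∀ y, y ≠ 0 → 0 ≤ ε * (α (X y) - α (X y₀))) (w : V) :
    0 ≤ ε * (B w w - α (X y₀) * fderiv ℝ (fderiv ℝ L) y₀ w w) := by
  set κ := α (X y₀) with hκ
  have hne : ∀ᶠ s : ℝ in 𝓝 0, y₀ + s • w ≠ 0 := by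
    have hc : ContinuousAt (fun s : ℝ => y₀ + s • w) 0 := by fun_prop
    exact hc.eventually_ne (by simpa using hy₀)
  -- Off the origin `½ B - κ L = L (α(X) - κ)`, so `φ` is nonnegative near `0` and vanishes at `0`.
  refine secondDeriv_nonneg_of_isLocalMin (x := 0)
    (φ := fun s => ε * (1 / 2 * B (y₀ + s • w) (y₀ + s • w) - κ * L (y₀ + s • w)))
    (φ' := fun s => ε * (1 / 2 * (2 * B (y₀ + s • w) w) - κ * fderiv ℝ L (y₀ + s • w) w))
    ?_ ?_ ?_
  · filter_upwards [hne] with s hs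
    have h1 := hext _ hs
    have h2 := h.pos hs
    have h3 := h.star_eq _ hs
    have h4 := h.star_eq _ hy₀
    change ε * (1 / 2 * B (y₀ + (0 : ℝ) • w) (y₀ + (0 : ℝ) • w) - κ * L (y₀ + (0 : ℝ) • w)) ≤
      ε * (1 / 2 * B (y₀ + s • w) (y₀ + s • w) - κ * L (y₀ + s • w))
    rw [zero_smul, add_zero, ← h3, ← h4]
    have : 0 ≤ L (y₀ + s • w) * (ε * (α (X (y₀ + s • w)) - κ)) := mul_nonneg h2.le h1
    rw [← hκ]
    linarith
  · filter_upwards [hne] with s hs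
    exact (((hasDerivAt_form_line h.form_comm y₀ w s).const_mul _).sub
      ((hasDerivAt_line (h.differentiableAt hs)).const_mul κ)).const_mul ε
  · have hy : y₀ + (0 : ℝ) • w ≠ 0 := by simpa using hy₀
    have h1 : HasDerivAt (fun s : ℝ => B (y₀ + s • w) w) (B w w) 0 := by
      have := hasDerivAt_line (f := fun y => B y w) (v := y₀) (w := w) (t := 0)
        (by fun_prop)
      have h2 : fderiv ℝ (fun y => B y w) (y₀ + (0 : ℝ) • w) = B.flip w :=
        (B.flip w).hasFDerivAt.fderiv
      rw [h2] at this
      exact this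
    have h2 := (hasDerivAt_line (h.differentiableAt_fderiv hy)).clm_apply
      (hasDerivAt_const (0 : ℝ) w)
    have h3 := (((h1.const_mul 2).const_mul (1 / 2)).sub (h2.const_mul κ)).const_mul ε
    refine h3.congr_deriv ?_
    simp

lemma form_cauchySchwarz (u w : V) : B u w ^ 2 ≤ B u u * B w w := by
  rcases eq_or_ne w 0 with rfl | hw
  · simp
  have hww : 0 < B w w := h.form_pos w hw
  have key : 0 ≤ B (B w w • u - B u w • w) (B w w • u - B u w • w) := by
    rcases eq_or_ne (B w w • u - B u w • w) 0 with h0 | h0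
    · simp [h0]
    · exact (h.form_pos _ h0).le
  simp only [map_sub, map_smul, sub_apply, smul_apply, smul_eq_mul, h.form_comm w u] at key
  have : 0 ≤ B w w * (B u u * B w w - B u w ^ 2) := by nlinarith
  have := nonneg_of_mul_nonneg_right this hww
  linarith

lemma hessian_grad_grad (hy : y ≠ 0) : fderiv ℝ (fderiv ℝ L) y (X y) (X y) = α (X y) :=
  h.hessian_grad y _ hy

/-- Cauchy–Schwarz for `X y` and `Xs`. It yields both `α(Xs) ≤ 1` and the monotonicity of the
Wronskian. -/
lemma sq_le_apply_grad_mul (hy : y ≠ 0) :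
    α Xs ^ 2 ≤ α (X y) * fderiv ℝ (fderiv ℝ L) y Xs Xs := by
  have := h.hessian_cauchySchwarz hy (X y) Xs
  rwa [h.hessian_grad y _ hy, h.hessian_grad y _ hy] at this

lemma apply_gradStar_pos : 0 < α Xs := by
  rw [← h.form_gradStar]
  exact h.form_pos _ h.gradStar_ne_zero

/-- Since `α(X)` is constant on rays, its extrema on the compact unit sphere are global. -/
lemma exists_extrema [FiniteDimensional ℝ V] :
    (∃ y₀ : V, y₀ ≠ 0 ∧ ∀ y, y ≠ 0 → α (X y₀) ≤ α (X y)) ∧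
      ∃ y₁ : V, y₁ ≠ 0 ∧ ∀ y, y ≠ 0 → α (X y) ≤ α (X y₁) := by
  have : ProperSpace V := FiniteDimensional.proper ℝ V
  have hc : IsCompact (Metric.sphere (0 : V) 1) := isCompact_sphere 0 1
  have hnorm : ∀ y : V, y ≠ 0 → ‖y‖⁻¹ • y ∈ Metric.sphere (0 : V) 1 := fun y hy => by
    simp [norm_smul, norm_ne_zero_iff.2 hy]
  have hsph : ∀ y ∈ Metric.sphere (0 : V) 1, y ≠ 0 := fun y hy =>
    ne_zero_of_mem_unit_sphere ⟨y, hy⟩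
  have hne : (Metric.sphere (0 : V) 1).Nonempty := ⟨_, hnorm Xs h.gradStar_ne_zero⟩
  have hcont : ContinuousOn (fun y => α (X y)) (Metric.sphere (0 : V) 1) := fun y hy =>
    (α.continuous.continuousAt.comp
      (h.differentiableAt_grad y (hsph y hy)).continuousAt).continuousWithinAt
  obtain ⟨y₀, hy₀, h₀⟩ := hc.exists_isMinOn hne hcont
  obtain ⟨y₁, hy₁, h₁⟩ := hc.exists_isMaxOn hne hcont
  refine ⟨⟨y₀, hsph y₀ hy₀, fun y hy => ?_⟩, ⟨y₁, hsph y₁ hy₁, fun y hy => ?_⟩⟩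
  · rw [← h.apply_grad_smul hy (inv_pos.2 (norm_pos_iff.2 hy))]
    exact h₀ (hnorm y hy)
  · rw [← h.apply_grad_smul hy (inv_pos.2 (norm_pos_iff.2 hy))]
    exact h₁ (hnorm y hy)

lemma apply_gradStar_eq_one [FiniteDimensional ℝ V] : α Xs = 1 := by
  obtain ⟨⟨y₀, hy₀, h₀⟩, y₁, hy₁, h₁⟩ := h.exists_extrema
  have hb := h.apply_gradStar_pos
  apply le_antisymm
  -- With minimum value `κ`: `α(Xs)² ≤ κ g(Xs, Xs) ≤ B(Xs, Xs) = α(Xs)`.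
  · have h2 := h.form_comparison hy₀ (ε := 1) (fun y hy => by linarith [h₀ y hy]) Xs
    have h3 := h.sq_le_apply_grad_mul hy₀
    rw [h.form_gradStar] at h2
    nlinarith
  -- With maximum value `κ` and test vector `X = X y₁`: `κ² = B(Xs, X)² ≤ α(Xs) B(X, X) ≤ α(Xs) κ²`.
  · have h2 := h.form_comparison hy₁ (ε := -1) (fun y hy => by linarith [h₁ y hy]) (X y₁)
    have h3 := h.form_cauchySchwarz Xs (X y₁)
    have h4 := h.apply_grad_pos hy₁
    rw [h.hessian_grad_grad hy₁] at h2
    rw [h.form_gradStar, h.form_gradStar] at h3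
    have h5 : α Xs * B (X y₁) (X y₁) ≤ α Xs * α (X y₁) ^ 2 :=
      mul_le_mul_of_nonneg_left (by linarith) hb.le
    have h6 : 0 ≤ α (X y₁) ^ 2 * (α Xs - 1) := by linarith
    have := nonneg_of_mul_nonneg_right h6 (by positivity)
    linarith

/-- `L²` times the derivative of `α(X)` in the direction `w`. -/
lemma fderiv_apply_grad (hy : y ≠ 0) (w : V) :
    B y w * L y - 1 / 2 * B y y * fderiv ℝ L y w =
      - L y ^ 2 * fderiv ℝ (fderiv ℝ (fderiv ℝ L)) y w (X y) (X y) := by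
  have hXd := (h.differentiableAt_grad y hy).hasFDerivAt
  have hev : ∀ᶠ z in 𝓝 y, z ≠ 0 := isOpen_ne.mem_nhds hy
  have h1 : fderiv ℝ (fderiv ℝ (fderiv ℝ L)) y w (X y) (X y) +
      α (fderiv ℝ X y w) = 0 := by
    -- Differentiates `g_z(X z, u) = α(u)` at `z = y` with `u` frozen at `X y`.
    have e1 := ((h.differentiableAt_hessian hy).hasFDerivAt.clm_apply hXd).clm_apply
      (hasFDerivAt_const (X y) y)
    have e2 := e1.unique ((hasFDerivAt_const (α (X y)) y).congr_of_eventuallyEq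
      (hev.mono fun z hz => h.hessian_grad z (X y) hz))
    have e3 := congrArg (fun T : V →L[ℝ] ℝ => T w) e2
    have e4 := h.hessian_grad y (fderiv ℝ X y w) hy
    rw [h.hessian_comm hy] at e4
    rw [← e4]
    simp at e3
    linarith
  have h2 : L y * α (fderiv ℝ X y w) + α (X y) * fderiv ℝ L y w = B y w := by
    have e1 := (h.differentiableAt hy).hasFDerivAt.mul (α.hasFDerivAt.comp y hXd)
    have e5 : HasFDerivAt (fun z => B z z) ((B y).comp (ContinuousLinearMap.id ℝ V) + B.flip y) y :=
      B.hasFDerivAt.clm_apply (hasFDerivAt_id y)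
    have e2 := e1.unique ((e5.const_mul (1 / 2)).congr_of_eventuallyEq
      (hev.mono fun z hz => h.star_eq z hz))
    have e3 := congrArg (fun T : V →L[ℝ] ℝ => T w) e2
    simp [h.form_comm w y] at e3
    linarith
  rw [← h.star_eq y hy, ← h2]
  linear_combination L y ^ 2 * h1

end HasQuadraticStar
end Rigidity

/-! ### Rigidity: the Wronskian along lines parallel to `Xs` -/

section Rigidity

variable {V : Type*} [NormedAddCommGroup V] [NormedSpace ℝ V]

lemma tendsto_clm_apply {ι E G : Type*} [NormedAddCommGroup E] [NormedSpace ℝ E]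
    [NormedAddCommGroup G] [NormedSpace ℝ G] {l : Filter ι} {f : ι → E →L[ℝ] G} {f₀ : E →L[ℝ] G}
    {u : ι → E} {u₀ : E} (hf : Tendsto f l (𝓝 f₀)) (hu : Tendsto u l (𝓝 u₀)) :
    Tendsto (fun i => f i (u i)) l (𝓝 (f₀ u₀)) :=
  (isBoundedBilinearMap_apply.continuous.tendsto (f₀, u₀)).comp (hf.prodMk_nhds hu)

/-- The Wronskian of `L` and `½ B` along the line `t ↦ v + t w`. -/
noncomputable def wronskian (L : V → ℝ) (B : V →L[ℝ] V →L[ℝ] ℝ) (w v : V) (t : ℝ) : ℝ :=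
  B (v + t • w) w * L (v + t • w) -
    1 / 2 * B (v + t • w) (v + t • w) * fderiv ℝ L (v + t • w) w

lemma wronskian_neg (L : V → ℝ) (B : V →L[ℝ] V →L[ℝ] ℝ) (w v : V) (t : ℝ) :
    wronskian L B (-w) v (-t) = -wronskian L B w v t := by
  simp only [wronskian, neg_smul_neg, map_neg]
  ring

namespace HasQuadraticStar

variable {L : V → ℝ} {α : V →L[ℝ] ℝ} {X : V → V} {B : V →L[ℝ] V →L[ℝ] ℝ} {Xs : V}
  (h : HasQuadraticStar L α X B Xs) {y v : V}
include h

lemma hasDerivAt_wronskian {t : ℝ} (ht : v + t • Xs ≠ 0) :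
    HasDerivAt (wronskian L B Xs v) (B Xs Xs * L (v + t • Xs) -
      1 / 2 * B (v + t • Xs) (v + t • Xs) * fderiv ℝ (fderiv ℝ L) (v + t • Xs) Xs Xs) t := by
  have h1 : HasDerivAt (fun s : ℝ => B (v + s • Xs) Xs) (B Xs Xs) t := by
    have := hasDerivAt_line (f := fun y => B y Xs) (v := v) (w := Xs) (t := t) (by fun_prop)
    have h2 : fderiv ℝ (fun y => B y Xs) (v + t • Xs) = B.flip Xs := (B.flip Xs).hasFDerivAt.fderiv
    rw [h2] at this
    exact this
  have h2 := hasDerivAt_line (h.differentiableAt ht)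
  have h3 := (hasDerivAt_line (h.differentiableAt_fderiv ht)).clm_apply (hasDerivAt_const t Xs)
  have h4 := (hasDerivAt_form_line h.form_comm v Xs t).const_mul (1 / 2)
  refine ((h1.mul h2).sub (h4.mul h3)).congr_deriv ?_
  simp
  ring

lemma hasDerivAt_apply_grad {t : ℝ} (ht : v + t • Xs ≠ 0) :
    HasDerivAt (fun s : ℝ => α (X (v + s • Xs)))
      (wronskian L B Xs v t / L (v + t • Xs) ^ 2) t := by
  have h2 := hasDerivAt_line (h.differentiableAt ht)
  have h4 := (hasDerivAt_form_line h.form_comm v Xs t).const_mul (1 / 2)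
  have h5 := h4.div h2 (h.pos ht).ne'
  refine (h5.congr_of_eventuallyEq ?_).congr_deriv ?_
  · have hc : ContinuousAt (fun s : ℝ => v + s • Xs) t := by fun_prop
    filter_upwards [hc.eventually_ne ht] with s hs using h.apply_grad_eq hs
  · simp only [wronskian]
    ring

/-- By `α(Xs) = 1` and `½ B = L α(X)` the derivative equals `L (1 - α(X) g(Xs, Xs))`, which
Cauchy–Schwarz makes nonpositive. -/
lemma antitone_wronskian (h1 : α Xs = 1) (hv : ∀ t : ℝ, v + t • Xs ≠ 0) :
    Antitone (wronskian L B Xs v) := by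
  refine antitone_of_deriv_nonpos (fun t => (h.hasDerivAt_wronskian (hv t)).differentiableAt)
    fun t => ?_
  rw [(h.hasDerivAt_wronskian (hv t)).deriv, h.form_gradStar, h1, ← h.star_eq _ (hv t)]
  have h2 := h.sq_le_apply_grad_mul (hv t)
  rw [h1] at h2
  have h3 := h.pos (hv t)
  nlinarith

/-- The equality case of Cauchy–Schwarz: at `Xs` one has `g(Xs, Xs) = 2L` and `2L α(X) = B(Xs, Xs) =
1`, so the difference of the two sides has `g`-length zero. -/
lemma grad_gradStar (h1 : α Xs = 1) : X Xs = α (X Xs) • Xs := by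
  by_contra hne
  have h0 := h.gradStar_ne_zero
  have h2 := h.convex Xs _ h0 (sub_ne_zero.2 hne)
  have h3 := h.hessian_comm h0 Xs (X Xs)
  have h4 := h.star_eq _ h0
  rw [h.form_gradStar, h1] at h4
  simp only [map_sub, map_smul, sub_apply, smul_apply, smul_eq_mul, h3, h.hessian_grad _ _ h0,
    h.hessian_self_left h0, h.fderiv_self h0, h1] at h2
  have h5 : α (X Xs) * (L Xs * α (X Xs)) = α (X Xs) * (1 / 2 * 1) := by rw [h4]
  linarith

/-- The point `v + ε⁻¹ Xs` is `ε⁻¹ y` with `y = Xs + ε v`, and in `Xs = y - ε v` the radial part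
contributes nothing to the Wronskian. Scaling leaves a factor `ε⁻²`, shared between the two copies
of `X`, from which a multiple of `y` may be subtracted for free. -/
lemma wronskian_inv {ε : ℝ} (hε : 0 < ε) (hy : Xs + ε • v ≠ 0) :
    wronskian L B Xs v ε⁻¹ = L (Xs + ε • v) ^ 2 *
      fderiv ℝ (fderiv ℝ (fderiv ℝ L)) (Xs + ε • v) v
        (ε⁻¹ • (X (Xs + ε • v) - α (X Xs) • (Xs + ε • v)))
        (ε⁻¹ • (X (Xs + ε • v) - α (X Xs) • (Xs + ε • v))) := by
  set y := Xs + ε • v with hyd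
  set σ := X y - α (X Xs) • y with hσ
  have hc : v + ε⁻¹ • Xs = ε⁻¹ • y := by
    rw [hyd, smul_add, smul_smul, inv_mul_cancel₀ hε.ne', one_smul, add_comm]
  have hXy : X y = σ + α (X Xs) • y := by rw [hσ, sub_add_cancel]
  have hfd := h.fderiv_apply_grad hy v
  rw [hXy, h.fderiv_hessian_add_smul hy] at hfd
  have hXs : Xs = y - ε • v := by rw [hyd, add_sub_cancel_right]
  have e1 : B y Xs = B y y - ε * B y v := by
    conv_lhs => rw [hXs]
    simp
  have e2 : fderiv ℝ L y Xs = 2 * L y - ε * fderiv ℝ L y v := by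
    conv_lhs => rw [hXs]
    simp [h.fderiv_self hy]
  unfold wronskian
  rw [hc, h.smul y _ (inv_pos.2 hε), h.fderiv_smul (inv_pos.2 hε)]
  simp only [map_smul, smul_apply, smul_eq_mul, e1, e2]
  field_simp
  linear_combination (-2) * ε * hfd

/-- By `grad_gradStar` the bracket in `wronskian_inv` vanishes at `ε = 0`; divided by `ε` it is a
difference quotient and converges. -/
lemma tendsto_wronskian (h1 : α Xs = 1) (hv : ∀ t : ℝ, v + t • Xs ≠ 0) :
    Tendsto (wronskian L B Xs v) atTop (𝓝 (L Xs ^ 2 *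
      fderiv ℝ (fderiv ℝ (fderiv ℝ L)) Xs v (fderiv ℝ X Xs v - α (X Xs) • v)
        (fderiv ℝ X Xs v - α (X Xs) • v))) := by
  have h0 := h.gradStar_ne_zero
  have hline : Tendsto (fun ε : ℝ => Xs + ε • v) (𝓝[>] 0) (𝓝 Xs) := by
    have : ContinuousAt (fun ε : ℝ => Xs + ε • v) 0 := by fun_prop
    have h2 := this.tendsto
    simp only [zero_smul, add_zero] at h2
    exact h2.mono_left nhdsWithin_le_nhds
  have hσ : Tendsto (fun ε : ℝ => ε⁻¹ • (X (Xs + ε • v) - α (X Xs) • (Xs + ε • v))) (𝓝[>] 0)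
      (𝓝 (fderiv ℝ X Xs v - α (X Xs) • v)) := by
    have e0 : Xs + (0 : ℝ) • v = Xs := by simp
    have e1 : HasDerivAt (fun ε : ℝ => X (Xs + ε • v)) (fderiv ℝ X Xs v) 0 := by
      have := hasDerivAt_line (f := X) (v := Xs) (w := v) (t := 0)
        (by rw [e0]; exact h.differentiableAt_grad _ h0)
      rwa [e0] at this
    have e2 : HasDerivAt (fun ε : ℝ => Xs + ε • v) v 0 := by
      simpa using ((hasDerivAt_id (0 : ℝ)).smul_const v).const_add Xs
    have e3 := (hasDerivAt_iff_tendsto_slope_zero.1 (e1.sub (e2.const_smul (α (X Xs))))).mono_left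
      (nhdsGT_le_nhdsNE (0 : ℝ))
    refine e3.congr fun ε => ?_
    simp only [zero_add, e0, Pi.sub_apply, Pi.smul_apply]
    rw [← h.grad_gradStar h1, sub_self, sub_zero]
  have hT : Tendsto (fun ε : ℝ => fderiv ℝ (fderiv ℝ (fderiv ℝ L)) (Xs + ε • v)) (𝓝[>] 0)
      (𝓝 (fderiv ℝ (fderiv ℝ (fderiv ℝ L)) Xs)) :=
    ((h.contDiffAt_hessian h0).continuousAt_fderiv one_ne_zero).tendsto.comp hline
  have hLc : Tendsto (fun ε : ℝ => L (Xs + ε • v)) (𝓝[>] 0) (𝓝 (L Xs)) :=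
    (h.differentiableAt h0).continuousAt.tendsto.comp hline
  have hlim := (hLc.pow 2).mul (tendsto_clm_apply (tendsto_clm_apply (hT.eval_const v) hσ) hσ)
  refine (hlim.comp tendsto_inv_atTop_nhdsGT_zero).congr' ?_
  filter_upwards [eventually_gt_atTop 0] with t ht
  have hne : Xs + t⁻¹ • v ≠ 0 := by
    intro h2
    apply hv t
    have : t • (Xs + t⁻¹ • v) = v + t • Xs := by
      rw [smul_add, smul_smul, mul_inv_cancel₀ ht.ne', one_smul, add_comm]
    rw [← this, h2, smul_zero]
  have := h.wronskian_inv (v := v) (inv_pos.2 ht) hne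
  rw [inv_inv] at this
  simp only [Function.comp_apply, this, inv_inv]

/-- The limit is homogeneous cubic in `v`, hence odd. -/
lemma exists_tendsto_wronskian (h1 : α Xs = 1) (hv : ∀ t : ℝ, v + t • Xs ≠ 0) :
    ∃ l : ℝ, Tendsto (wronskian L B Xs v) atTop (𝓝 l) ∧
      Tendsto (wronskian L B Xs (-v)) atTop (𝓝 (-l)) := by
  refine ⟨_, h.tendsto_wronskian h1 hv, ?_⟩
  have hv' : ∀ t : ℝ, -v + t • Xs ≠ 0 := fun t h2 => hv (-t) <| by
    rw [← neg_eq_zero, ← h2, neg_smul]; abel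
  convert h.tendsto_wronskian h1 hv' using 2
  simp only [map_neg, smul_neg, sub_neg_eq_add, neg_apply]
  rw [show -fderiv ℝ X Xs v + α (X Xs) • v = -(fderiv ℝ X Xs v - α (X Xs) • v) by abel]
  simp only [map_neg, neg_apply]
  ring

/-- Let `l` and `-m` be the limits for `v` at `∞` and `-∞`; those for `-v` are `-l` and `m`.
Decrease along the first line gives `l ≤ -m`, along the second `-l ≤ m`, so all inequalities are
equalities. -/
lemma exists_wronskian_eq (h1 : α Xs = 1) (hv : ∀ t : ℝ, v + t • Xs ≠ 0) :
    ∃ l : ℝ, (∀ t, wronskian L B Xs v t = l) ∧ ∀ t, wronskian L B Xs (-v) t = -l := by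
  have hvs : ∀ t : ℝ, v + t • -Xs ≠ 0 := fun t => by simpa using hv (-t)
  have hv' : ∀ t : ℝ, -v + t • Xs ≠ 0 := fun t h2 => hv (-t) <| by
    rw [← neg_eq_zero, ← h2, neg_smul]; abel
  obtain ⟨l, hl, hl'⟩ := h.exists_tendsto_wronskian h1 hv
  obtain ⟨m, hm, hm'⟩ := h.neg.exists_tendsto_wronskian (by simpa using h1) hvs
  have bot : ∀ u k, Tendsto (wronskian L B (-Xs) u) atTop (𝓝 k) →
      Tendsto (wronskian L B Xs u) atBot (𝓝 (-k)) := fun u k hk => by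
    refine (hk.neg.comp tendsto_neg_atBot_atTop).congr fun t => ?_
    simp [wronskian_neg]
  have b1 := bot _ _ hm
  have b2 := bot _ _ hm'
  have a1 := h.antitone_wronskian h1 hv
  have a2 := h.antitone_wronskian h1 hv'
  have i1 : ∀ t, l ≤ wronskian L B Xs v t ∧ wronskian L B Xs v t ≤ -m := fun t =>
    ⟨a1.le_of_tendsto hl t, a1.ge_of_tendsto b1 t⟩
  have i2 : ∀ t, -l ≤ wronskian L B Xs (-v) t ∧ wronskian L B Xs (-v) t ≤ - -m := fun t =>
    ⟨a2.le_of_tendsto hl' t, a2.ge_of_tendsto b2 t⟩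
  have hlm : l = -m := by linarith [(i1 0).1, (i1 0).2, (i2 0).1, (i2 0).2]
  exact ⟨l, fun t => by linarith [(i1 t).1, (i1 t).2], fun t => by linarith [(i2 t).1, (i2 t).2]⟩

/-- By constancy on rays the value at `v + t Xs` is the value at `Xs + t⁻¹ v`. -/
lemma tendsto_apply_grad (hv : ∀ t : ℝ, v + t • Xs ≠ 0) :
    Tendsto (fun t : ℝ => α (X (v + t • Xs))) atTop (𝓝 (α (X Xs))) := by
  have hline : Tendsto (fun t : ℝ => Xs + t⁻¹ • v) atTop (𝓝 Xs) := by
    simpa using ((tendsto_inv_atTop_zero (𝕜 := ℝ)).smul_const v).const_add Xs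
  have h2 := (α.continuous.continuousAt.comp
    (h.differentiableAt_grad _ h.gradStar_ne_zero).continuousAt).tendsto.comp hline
  refine h2.congr' ?_
  filter_upwards [eventually_gt_atTop 0] with t ht
  have : t⁻¹ • (v + t • Xs) = Xs + t⁻¹ • v := by
    rw [smul_add, smul_smul, inv_mul_cancel₀ ht.ne', one_smul, add_comm]
  simp only [Function.comp_apply]
  rw [← this, h.apply_grad_smul (hv t) (inv_pos.2 ht)]

lemma apply_grad_between (hv : ∀ t : ℝ, v + t • Xs ≠ 0)
    (hw : ∀ t, 0 ≤ wronskian L B Xs v t) (t : ℝ) :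
    α (X (-Xs)) ≤ α (X (v + t • Xs)) ∧ α (X (v + t • Xs)) ≤ α (X Xs) := by
  have hvs : ∀ t : ℝ, v + t • -Xs ≠ 0 := fun t => by simpa using hv (-t)
  have hmono : Monotone fun t : ℝ => α (X (v + t • Xs)) := by
    refine monotone_of_deriv_nonneg
      (fun t => (h.hasDerivAt_apply_grad (hv t)).differentiableAt) fun t => ?_
    rw [(h.hasDerivAt_apply_grad (hv t)).deriv]
    exact div_nonneg (hw t) (sq_nonneg _)
  have hbot : Tendsto (fun t : ℝ => α (X (v + t • Xs))) atBot (𝓝 (α (X (-Xs)))) := by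
    have := (h.neg.tendsto_apply_grad hvs).comp tendsto_neg_atBot_atTop
    simpa [Function.comp_def] using this
  exact ⟨hmono.le_of_tendsto hbot t, hmono.ge_of_tendsto (h.tendsto_apply_grad hv) t⟩

lemma apply_grad_eq_of_line (h1 : α Xs = 1) (hv : ∀ t : ℝ, v + t • Xs ≠ 0) :
    α (X v) = α (X Xs) ∧ α (X (-Xs)) = α (X Xs) := by
  have hv' : ∀ t : ℝ, -v + t • Xs ≠ 0 := fun t h2 => hv (-t) <| by
    rw [← neg_eq_zero, ← h2, neg_smul]; abel
  have hvs : ∀ t : ℝ, v + t • -Xs ≠ 0 := fun t => by simpa using hv (-t)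
  have hvs' : ∀ t : ℝ, -v + t • -Xs ≠ 0 := fun t => by simpa using hv' (-t)
  obtain ⟨l, hl, hl'⟩ := h.exists_wronskian_eq h1 hv
  have hneg : ∀ u t, wronskian L B (-Xs) u t = -wronskian L B Xs u (-t) := fun u t => by
    rw [← wronskian_neg, neg_neg]
  -- One of the lines through `v` and `-v` has a nonnegative Wronskian in the direction `Xs`, the
  -- other in the direction `-Xs`. They bound the values at `Xs` and `-Xs` by each other in both
  -- senses.
  rcases le_total 0 l with h0 | h0
  · have i1 := h.apply_grad_between hv (fun t => by rw [hl]; exact h0) 0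
    have i2 := h.neg.apply_grad_between hvs' (fun t => by rw [hneg, hl']; linarith) 0
    simp at i1 i2
    constructor <;> linarith
  · have i1 := h.apply_grad_between hv' (fun t => by rw [hl']; linarith) 0
    have i2 := h.neg.apply_grad_between hvs (fun t => by rw [hneg, hl]; linarith) 0
    simp at i1 i2
    constructor <;> linarith

/-- Rigidity: if `L · α(X)` is a quadratic form, then `α(X)` is constant. -/
theorem apply_grad_eq_const [FiniteDimensional ℝ V] (hV : 1 < Module.finrank ℝ V) (hy : y ≠ 0) :
    α (X y) = α (X Xs) := by
  have h1 := h.apply_gradStar_eq_one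
  by_cases hv : ∀ t : ℝ, y + t • Xs ≠ 0
  · exact (h.apply_grad_eq_of_line h1 hv).1
  push Not at hv
  obtain ⟨t, ht⟩ := hv
  have hyt : y = (-t) • Xs := by rw [neg_smul]; exact eq_neg_of_add_eq_zero_left ht
  have ht0 : t ≠ 0 := by rintro rfl; simp at hyt; exact hy hyt
  -- Positive multiples of `Xs` lie on its ray. For negative ones, a line off the axis, available in
  -- dimension at least two, compares `-Xs` with `Xs`.
  rcases lt_or_gt_of_ne ht0 with ht | ht
  · rw [hyt, h.apply_grad_smul h.gradStar_ne_zero (by linarith)]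
  · obtain ⟨v, hv⟩ : ∃ v : V, v ∉ Submodule.span ℝ {Xs} := by
      by_contra! hall
      have := finrank_span_singleton (K := ℝ) h.gradStar_ne_zero
      rw [(Submodule.eq_top_iff'.2 hall), finrank_top] at this
      omega
    have hv' : ∀ t : ℝ, v + t • Xs ≠ 0 := fun t h2 => hv <| Submodule.mem_span_singleton.2
      ⟨-t, by rw [neg_smul]; exact (eq_neg_of_add_eq_zero_left h2).symm⟩
    rw [hyt, neg_smul, ← smul_neg, h.apply_grad_smul (neg_ne_zero.2 h.gradStar_ne_zero) ht]
    exact (h.apply_grad_eq_of_line h1 hv').2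

end HasQuadraticStar
end Rigidity

/-! ### Partial derivatives, Hessian matrices and gradients in coordinates -/

section Coordinates

variable {n : ℕ}

lemma clm_apply_eq_sum (T : Vec n →L[ℝ] ℝ) (w : Vec n) :
    T w = ∑ i, w i * T (EuclideanSpace.single i 1) := by
  conv_lhs => rw [← (EuclideanSpace.basisFun (Fin n) ℝ).sum_repr w]
  simp [map_sum]

lemma clm_ext_single {T T' : Vec n →L[ℝ] ℝ}
    (h : ∀ i, T (EuclideanSpace.single i 1) = T' (EuclideanSpace.single i 1)) : T = T' := by
  ext w
  rw [clm_apply_eq_sum T, clm_apply_eq_sum T']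
  simp [h]

/-- The linear form with components `a`. -/
noncomputable def covector (a : Fin n → ℝ) : Vec n →L[ℝ] ℝ :=
  innerSL ℝ (WithLp.toLp 2 a : Vec n)

lemma covector_apply (a : Fin n → ℝ) (w : Vec n) : covector a w = ∑ i, w i * a i := by
  simp [covector, PiLp.inner_apply]

lemma covector_single (a : Fin n → ℝ) (i : Fin n) :
    covector a (EuclideanSpace.single i 1) = a i := by
  simp [covector_apply]

lemma contDiffOn_pd {S : Set (Vec n)} (hS : IsOpen S) {f : Vec n → ℝ} (hf : ContDiffOn ℝ ∞ f S)
    (i : Fin n) : ContDiffOn ℝ ∞ (pd i f) S :=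
  (hf.fderiv_of_isOpen hS (by simp)).clm_apply contDiffOn_const

lemma pd_const_mul (c : ℝ) (f : Vec n → ℝ) (i : Fin n) :
    pd i (fun y => c * f y) = fun y => c * pd i f y := by
  funext y
  have : fderiv ℝ (fun z => c * f z) y = c • fderiv ℝ f y :=
    congrFun (fderiv_const_smul_field (𝕜 := ℝ) (f := f) c) y
  simp [pd, this]

lemma pd_congr {S : Set (Vec n)} (hS : IsOpen S) {f g : Vec n → ℝ} (h : Set.EqOn f g S)
    (i : Fin n) : Set.EqOn (pd i f) (pd i g) S := fun y hy => by
  have : f =ᶠ[𝓝 y] g := eventuallyEq_of_mem (hS.mem_nhds hy) h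
  simp only [pd, this.fderiv_eq]

lemma pd_sub {S : Set (Vec n)} (hS : IsOpen S) {f g : Vec n → ℝ} (hf : ContDiffOn ℝ ∞ f S)
    (hg : ContDiffOn ℝ ∞ g S) (i : Fin n) :
    Set.EqOn (pd i fun y => f y - g y) (fun y => pd i f y - pd i g y) S := fun y hy => by
  have hf' := ((hf y hy).contDiffAt (hS.mem_nhds hy)).differentiableAt (by simp)
  have hg' := ((hg y hy).contDiffAt (hS.mem_nhds hy)).differentiableAt (by simp)
  simp [pd, fderiv_fun_sub hf' hg']

lemma pd_sum {S : Set (Vec n)} (hS : IsOpen S) {ι : Type*} [Fintype ι] {f : ι → Vec n → ℝ}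
    (hf : ∀ l, ContDiffOn ℝ ∞ (f l) S) (c : ι → ℝ) (i : Fin n) :
    Set.EqOn (pd i fun y => ∑ l, f l y * c l) (fun y => ∑ l, pd i (f l) y * c l) S := fun y hy => by
  have hf' : ∀ l, HasFDerivAt (fun z => f l z * c l) (c l • fderiv ℝ (f l) y) y := fun l =>
    (((hf l y hy).contDiffAt (hS.mem_nhds hy)).differentiableAt (by simp)).hasFDerivAt.mul_const _
  have := HasFDerivAt.fun_sum (u := Finset.univ) fun l _ => hf' l
  simp [pd, this.fderiv, mul_comm]

lemma pd_pd_pd_sum {S : Set (Vec n)} (hS : IsOpen S) {ι : Type*} [Fintype ι] {f : ι → Vec n → ℝ}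
    (hf : ∀ l, ContDiffOn ℝ ∞ (f l) S) (c : ι → ℝ) (i j k : Fin n) :
    Set.EqOn (pd k (pd j (pd i fun y => ∑ l, f l y * c l)))
      (fun y => ∑ l, pd k (pd j (pd i (f l))) y * c l) S := by
  have h1 := pd_sum hS hf c i
  have h2 := (pd_congr hS h1 j).trans (pd_sum hS (fun l => contDiffOn_pd hS (hf l) i) c j)
  exact (pd_congr hS h2 k).trans
    (pd_sum hS (fun l => contDiffOn_pd hS (contDiffOn_pd hS (hf l) i) j) c k)

lemma pd_pd_pd_sub {S : Set (Vec n)} (hS : IsOpen S) {f g : Vec n → ℝ} (hf : ContDiffOn ℝ ∞ f S)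
    (hg : ContDiffOn ℝ ∞ g S) (i j k : Fin n) :
    Set.EqOn (pd k (pd j (pd i fun y => f y - g y)))
      (fun y => pd k (pd j (pd i f)) y - pd k (pd j (pd i g)) y) S := by
  have h1 := pd_sub hS hf hg i
  have hf1 := contDiffOn_pd hS hf i
  have hg1 := contDiffOn_pd hS hg i
  have h2 := (pd_congr hS h1 j).trans (pd_sub hS hf1 hg1 j)
  exact (pd_congr hS h2 k).trans
    (pd_sub hS (contDiffOn_pd hS hf1 j) (contDiffOn_pd hS hg1 j) k)

lemma pd_pd_eq {f : Vec n → ℝ} {y : Vec n} (hf : DifferentiableAt ℝ (fderiv ℝ f) y)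
    (i j : Fin n) : pd j (pd i f) y =
      fderiv ℝ (fderiv ℝ f) y (EuclideanSpace.single j 1) (EuclideanSpace.single i 1) := by
  have := hf.hasFDerivAt.clm_apply (hasFDerivAt_const (EuclideanSpace.single i (1 : ℝ)) y)
  have h2 : fderiv ℝ (pd i f) y = _ := this.fderiv
  rw [pd, h2]
  simp

/-- The passage between `hess` and the invariant Hessian. The second index of `hess` is the outer
derivative, hence the first slot, so symmetry is not needed. -/
lemma hess_mulVec {f : Vec n → ℝ} {y : Vec n} (hf : DifferentiableAt ℝ (fderiv ℝ f) y)
    (u : Fin n → ℝ) (i : Fin n) : Matrix.mulVec (hess f y) u i =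
      fderiv ℝ (fderiv ℝ f) y (WithLp.toLp 2 u) (EuclideanSpace.single i 1) := by
  have := clm_apply_eq_sum ((fderiv ℝ (fderiv ℝ f) y).flip (EuclideanSpace.single i 1))
    (WithLp.toLp 2 u)
  rw [ContinuousLinearMap.flip_apply] at this
  rw [this]
  simp [Matrix.mulVec, dotProduct, hess, pd_pd_eq hf, mul_comm]

lemma hess_const_mul (c : ℝ) (f : Vec n → ℝ) (y : Vec n) :
    hess (fun z => c * f z) y = c • hess f y := by
  ext i j
  simp [hess, pd_const_mul]

lemma IsMinkowskiEnergy.isUnit_hess {L : Vec n → ℝ} (h : IsMinkowskiEnergy L) {y : Vec n}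
    (hy : y ≠ 0) : IsUnit (hess L y) := by
  rw [← Matrix.mulVec_injective_iff_isUnit]
  refine (injective_iff_map_eq_zero (Matrix.mulVecLin (hess L y))).2 fun u hu => ?_
  by_contra hne
  have hne' : (WithLp.toLp 2 u : Vec n) ≠ 0 := fun h0 => hne (by
    simpa using congrArg (WithLp.ofLp) h0)
  refine (h.convex y _ hy hne').ne' ?_
  have hz : fderiv ℝ (fderiv ℝ L) y (WithLp.toLp 2 u) = 0 := clm_ext_single fun i => by
    rw [← hess_mulVec (h.differentiableAt_fderiv hy)]
    simpa using congrFun hu i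
  simp [hz]

lemma hessian_grad {L : Vec n → ℝ} {y : Vec n} (hL : DifferentiableAt ℝ (fderiv ℝ L) y)
    (hu : IsUnit (hess L y)) (a : Fin n → ℝ) :
    fderiv ℝ (fderiv ℝ L) y (grad L a y) = covector a := clm_ext_single fun i => by
  rw [grad, ← hess_mulVec hL, Matrix.mulVec_mulVec, Matrix.mul_nonsing_inv _
    ((Matrix.isUnit_iff_isUnit_det _).1 hu), Matrix.one_mulVec, covector_single]

lemma grad_eq_of_hessian {L : Vec n → ℝ} {y : Vec n} (hL : DifferentiableAt ℝ (fderiv ℝ L) y)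
    (hu : IsUnit (hess L y)) {a : Fin n → ℝ} {w : Vec n}
    (hw : fderiv ℝ (fderiv ℝ L) y w = covector a) : grad L a y = w := by
  have : Matrix.mulVec (hess L y) (WithLp.ofLp w) = a := funext fun i => by
    rw [hess_mulVec hL, WithLp.toLp_ofLp, hw, covector_single]
  rw [grad, ← this, Matrix.mulVec_mulVec, Matrix.nonsing_inv_mul _
    ((Matrix.isUnit_iff_isUnit_det _).1 hu), Matrix.one_mulVec, WithLp.toLp_ofLp]

lemma contDiffOn_matrix_det {S : Set (Vec n)} {m : ℕ} {A : Vec n → Matrix (Fin m) (Fin m) ℝ}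
    (hA : ∀ i j, ContDiffOn ℝ ∞ (fun y => A y i j) S) : ContDiffOn ℝ ∞ (fun y => (A y).det) S := by
  simp only [Matrix.det_apply]
  exact ContDiffOn.sum fun σ _ => (contDiffOn_prod fun i _ => hA _ _).const_smul _

lemma contDiffOn_matrix_inv {S : Set (Vec n)} {m : ℕ} {A : Vec n → Matrix (Fin m) (Fin m) ℝ}
    (hA : ∀ i j, ContDiffOn ℝ ∞ (fun y => A y i j) S) (hu : ∀ y ∈ S, IsUnit (A y)) (i j : Fin m) :
    ContDiffOn ℝ ∞ (fun y => (A y)⁻¹ i j) S := by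
  -- Cramer's rule: adjugate entries are determinants with one row replaced by a constant unit
  -- vector.
  have h1 : ContDiffOn ℝ ∞ (fun y => (A y).adjugate i j) S := by
    simp only [Matrix.adjugate_apply]
    refine contDiffOn_matrix_det fun k l => ?_
    by_cases hk : k = j
    · subst hk
      simpa using contDiffOn_const
    · simpa [Matrix.updateRow_ne hk] using hA k l
  have h2 : ∀ y ∈ S, (A y).det ≠ 0 := fun y hy =>
    ((Matrix.isUnit_iff_isUnit_det _).1 (hu y hy)).ne_zero
  simpa [Matrix.inv_def, Ring.inverse_eq_inv'] using ((contDiffOn_matrix_det hA).inv h2).mul h1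

lemma contDiffOn_hess_inv {L : Vec n → ℝ} (hL : ContDiffOn ℝ ∞ L {0}ᶜ)
    (hu : ∀ y, y ≠ 0 → IsUnit (hess L y)) (i j : Fin n) :
    ContDiffOn ℝ ∞ (fun y => (hess L y)⁻¹ i j) {0}ᶜ :=
  contDiffOn_matrix_inv (fun k l => contDiffOn_pd isOpen_compl_singleton
    (contDiffOn_pd isOpen_compl_singleton hL k) l) (fun y hy => hu y hy) i j

lemma contDiffOn_grad {L : Vec n → ℝ} (hL : ContDiffOn ℝ ∞ L {0}ᶜ)
    (hu : ∀ y, y ≠ 0 → IsUnit (hess L y)) (a : Fin n → ℝ) :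
    ContDiffOn ℝ ∞ (grad L a) {0}ᶜ := by
  rw [contDiffOn_euclidean]
  intro i
  simp only [grad, Matrix.mulVec, dotProduct]
  exact ContDiffOn.sum fun j _ => (contDiffOn_hess_inv hL hu i j).mul contDiffOn_const

lemma energyStar_eq (L : Vec n → ℝ) (a : Fin n → ℝ) (y : Vec n) :
    energyStar L a y = L y * covector a (grad L a y) := by
  rw [covector_apply, energyStar]

end Coordinates

/-! ### The spray and its conformal change -/

section Spray

variable {n : ℕ} {Λ : Vec n → Vec n → ℝ} {U : Set (Vec n)}

lemma fderiv_fst_eq {G : Type*} [NormedAddCommGroup G] [NormedSpace ℝ G]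
    {Φ : Vec n × Vec n → G} {x y : Vec n} (hΦ : DifferentiableAt ℝ Φ (x, y)) :
    HasFDerivAt (fun x' => Φ (x', y)) ((fderiv ℝ Φ (x, y)).comp (.inl ℝ (Vec n) (Vec n))) x :=
  HasFDerivAt.comp x (f := fun x' => (x', y)) hΦ.hasFDerivAt (hasFDerivAt_prodMk_left x y)

lemma fderiv_snd_eq {G : Type*} [NormedAddCommGroup G] [NormedSpace ℝ G]
    {Φ : Vec n × Vec n → G} {x y : Vec n} (hΦ : DifferentiableAt ℝ Φ (x, y)) :
    HasFDerivAt (fun y' => Φ (x, y')) ((fderiv ℝ Φ (x, y)).comp (.inr ℝ (Vec n) (Vec n))) y :=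
  HasFDerivAt.comp y (f := fun y' => (x, y')) hΦ.hasFDerivAt (hasFDerivAt_prodMk_right x y)

lemma contDiffOn_slice {G : Type*} [NormedAddCommGroup G] [NormedSpace ℝ G]
    {Φ : Vec n × Vec n → G} {x : Vec n} (hΦ : ContDiffOn ℝ ∞ Φ (U ×ˢ {0}ᶜ)) (hx : x ∈ U) :
    ContDiffOn ℝ ∞ (fun y => Φ (x, y)) {0}ᶜ :=
  hΦ.comp (f := fun y => (x, y)) (by fun_prop) fun _ hy => ⟨hx, hy⟩

/-- `Λ x y` is smooth in `(x, y)` for `x` in the open set `U` and `y ≠ 0`. -/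
structure IsSmoothEnergy (Λ : Vec n → Vec n → ℝ) (U : Set (Vec n)) : Prop where
  isOpen : IsOpen U
  contDiffOn : ContDiffOn ℝ ∞ (fun z : Vec n × Vec n => Λ z.1 z.2) (U ×ˢ {0}ᶜ)

namespace IsSmoothEnergy

variable (h : IsSmoothEnergy Λ U) {x y : Vec n}
include h

lemma isOpen_prod : IsOpen (U ×ˢ ({0}ᶜ : Set (Vec n))) := h.isOpen.prod isOpen_compl_singleton

lemma contDiffOn_fderiv :
    ContDiffOn ℝ ∞ (fderiv ℝ fun z : Vec n × Vec n => Λ z.1 z.2) (U ×ˢ {0}ᶜ) :=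
  h.contDiffOn.fderiv_of_isOpen h.isOpen_prod (by simp)

lemma contDiffOn_fderiv_fderiv :
    ContDiffOn ℝ ∞ (fderiv ℝ (fderiv ℝ fun z : Vec n × Vec n => Λ z.1 z.2)) (U ×ˢ {0}ᶜ) :=
  h.contDiffOn_fderiv.fderiv_of_isOpen h.isOpen_prod (by simp)

lemma differentiableAt (hx : x ∈ U) (hy : y ≠ 0) :
    DifferentiableAt ℝ (fun z : Vec n × Vec n => Λ z.1 z.2) (x, y) :=
  (h.contDiffOn.contDiffAt (h.isOpen_prod.mem_nhds (Set.mk_mem_prod hx hy))).differentiableAt (by simp)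

lemma differentiableAt_fderiv (hx : x ∈ U) (hy : y ≠ 0) :
    DifferentiableAt ℝ (fderiv ℝ fun z : Vec n × Vec n => Λ z.1 z.2) (x, y) :=
  (h.contDiffOn_fderiv.contDiffAt (h.isOpen_prod.mem_nhds (Set.mk_mem_prod hx hy))).differentiableAt (by simp)

lemma pd_base (hx : x ∈ U) (hy : y ≠ 0) (m : Fin n) : pd m (fun x' => Λ x' y) x =
    fderiv ℝ (fun z : Vec n × Vec n => Λ z.1 z.2) (x, y) (EuclideanSpace.single m 1, 0) := by
  rw [pd, (fderiv_fst_eq (h.differentiableAt hx hy)).fderiv]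
  simp

lemma pd_fibre (hx : x ∈ U) (hy : y ≠ 0) (m : Fin n) : pd m (Λ x) y =
    fderiv ℝ (fun z : Vec n × Vec n => Λ z.1 z.2) (x, y) (0, EuclideanSpace.single m 1) := by
  rw [pd, (fderiv_snd_eq (h.differentiableAt hx hy)).fderiv]
  simp

/-- Expressing the mixed derivative through the full second derivative on the product exhibits its
smooth dependence on `y`, used in `contDiffOn_spray`. -/
lemma hasFDerivAt_pd_fibre (hx : x ∈ U) (hy : y ≠ 0) (m : Fin n) :
    ∃ T : Vec n →L[ℝ] ℝ, HasFDerivAt (fun x' => pd m (Λ x') y) T x ∧ ∀ u, T u =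
      fderiv ℝ (fderiv ℝ fun z : Vec n × Vec n => Λ z.1 z.2) (x, y) (u, 0)
        (0, EuclideanSpace.single m 1) := by
  have h1 := (fderiv_fst_eq (h.differentiableAt_fderiv hx hy)).clm_apply
    (hasFDerivAt_const ((0, EuclideanSpace.single m 1) : Vec n × Vec n) x)
  refine ⟨_, h1.congr_of_eventuallyEq ?_, fun u => by simp⟩
  filter_upwards [h.isOpen.mem_nhds hx] with x' hx' using h.pd_fibre hx' hy m

lemma contDiffOn_spray (hx : x ∈ U) (hu : ∀ y, y ≠ 0 → IsUnit (hess (Λ x) y)) (l : Fin n) :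
    ContDiffOn ℝ ∞ (spray Λ l x) {0}ᶜ := by
  have h1 : ContDiffOn ℝ ∞ (Λ x) {0}ᶜ := contDiffOn_slice h.contDiffOn hx
  have h2 : ∀ k m, ContDiffOn ℝ ∞ (fun y => pd k (fun x' => pd m (Λ x') y) x) {0}ᶜ := fun k m => by
    have h3 := ((contDiffOn_slice h.contDiffOn_fderiv_fderiv hx).clm_apply
      (contDiffOn_const (c := ((EuclideanSpace.single k 1, 0) : Vec n × Vec n)))).clm_apply
      (contDiffOn_const (c := ((0, EuclideanSpace.single m 1) : Vec n × Vec n)))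
    refine h3.congr fun y hy => ?_
    obtain ⟨T, hT, hT'⟩ := h.hasFDerivAt_pd_fibre hx hy m
    rw [pd, hT.fderiv, hT']
  have h4 : ∀ m, ContDiffOn ℝ ∞ (fun y => pd m (fun x' => Λ x' y) x) {0}ᶜ := fun m =>
    ((contDiffOn_slice h.contDiffOn_fderiv hx).clm_apply
      (contDiffOn_const (c := ((EuclideanSpace.single m 1, 0) : Vec n × Vec n)))).congr
      fun y hy => h.pd_base hx hy m
  have h5 : ∀ k : Fin n, ContDiffOn ℝ ∞ (fun y : Vec n => y k) {0}ᶜ := fun k => by fun_prop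
  refine contDiffOn_const.mul (ContDiffOn.sum fun m _ => (contDiffOn_hess_inv h1 hu l m).mul ?_)
  exact (ContDiffOn.sum fun k _ => (h5 k).mul (h2 k m)).sub (h4 m)

/-- The spray coefficients of the conformally changed energy `e^{2A} Λ`. -/
lemma spray_conformal (hx : x ∈ U) (hL : IsMinkowskiEnergy (Λ x)) (hy : y ≠ 0) {A : Vec n → ℝ}
    (hA : DifferentiableAt ℝ A x) (l : Fin n) :
    spray (fun x y => Real.exp (2 * A x) * Λ x y) l x y = spray Λ l x y +
      (covector (fun k => pd k A x) y * y l - Λ x y * grad (Λ x) (fun k => pd k A x) y l) := by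
  set a : Fin n → ℝ := fun k => pd k A x with ha
  set c := Real.exp (2 * A x) with hc
  have hc0 : c ≠ 0 := (Real.exp_pos _).ne'
  have hunit := (Matrix.isUnit_iff_isUnit_det _).1 (hL.isUnit_hess hy)
  have hexp : HasFDerivAt (fun x' => Real.exp (2 * A x')) (c • (2 : ℝ) • fderiv ℝ A x) x :=
    (hA.hasFDerivAt.const_mul 2).exp
  -- This `c⁻¹` cancels the common factor `c` of `e2` and `e4`.
  have e1 : (hess (fun y => c * Λ x y) y)⁻¹ = c⁻¹ • (hess (Λ x) y)⁻¹ := by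
    rw [hess_const_mul]
    refine Matrix.inv_eq_left_inv ?_
    rw [smul_mul_smul_comm, inv_mul_cancel₀ hc0, Matrix.nonsing_inv_mul _ hunit, one_smul]
  have e2 : ∀ k m, pd k (fun x' => pd m (fun y => Real.exp (2 * A x') * Λ x' y) y) x =
      c * (2 * a k * pd m (Λ x) y + pd k (fun x' => pd m (Λ x') y) x) := fun k m => by
    obtain ⟨T, hT, -⟩ := h.hasFDerivAt_pd_fibre hx hy m
    simp only [pd_const_mul]
    have h2 := hexp.mul hT
    have e3 : pd k (fun x' => Real.exp (2 * A x') * pd m (Λ x') y) x = _ :=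
      congrArg (fun T : Vec n →L[ℝ] ℝ => T (EuclideanSpace.single k 1)) h2.fderiv
    rw [e3, show pd k (fun x' => pd m (Λ x') y) x = T (EuclideanSpace.single k 1) by
      rw [pd, hT.fderiv]]
    simp [ha, pd]
    ring
  have e4 : ∀ m, pd m (fun x' => Real.exp (2 * A x') * Λ x' y) x =
      c * (2 * a m * Λ x y + pd m (fun x' => Λ x' y) x) := fun m => by
    have hT := fderiv_fst_eq (h.differentiableAt hx hy)
    have h2 := hexp.mul hT
    have e3 : pd m (fun x' => Real.exp (2 * A x') * Λ x' y) x = _ :=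
      congrArg (fun T : Vec n →L[ℝ] ℝ => T (EuclideanSpace.single m 1)) h2.fderiv
    rw [e3, show pd m (fun x' => Λ x' y) x = _ from
      congrArg (fun T : Vec n →L[ℝ] ℝ => T (EuclideanSpace.single m 1)) hT.fderiv]
    simp [ha, pd]
    ring
  -- Euler's relation `gₗₘ yᵐ = ∂L/∂yˡ`, solved for `y`; it turns one conformal term into a multiple
  -- of `yˡ`.
  have e5 : ∑ m, (hess (Λ x) y)⁻¹ l m * pd m (Λ x) y = y l := by
    have h1 : (fun m => pd m (Λ x) y) = Matrix.mulVec (hess (Λ x) y) (WithLp.ofLp y) :=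
      funext fun m => by
        rw [hess_mulVec (hL.differentiableAt_fderiv hy), WithLp.toLp_ofLp,
          hL.hessian_self_left hy, pd]
    have h2 : Matrix.mulVec (hess (Λ x) y)⁻¹ (fun m => pd m (Λ x) y) l = y l := by
      rw [h1, Matrix.mulVec_mulVec, Matrix.nonsing_inv_mul _ hunit, Matrix.one_mulVec]
    simpa [Matrix.mulVec, dotProduct] using h2
  have e6 : grad (Λ x) a y l = ∑ m, (hess (Λ x) y)⁻¹ l m * a m := by
    simp [grad, Matrix.mulVec, dotProduct]
  have e7 : ∀ m, c⁻¹ * (hess (Λ x) y)⁻¹ l m *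
      (∑ k, y k * (c * (2 * a k * pd m (Λ x) y + pd k (fun x' => pd m (Λ x') y) x)) -
        c * (2 * a m * Λ x y + pd m (fun x' => Λ x' y) x)) =
      (hess (Λ x) y)⁻¹ l m *
        ((∑ k, y k * pd k (fun x' => pd m (Λ x') y) x) - pd m (fun x' => Λ x' y) x) +
      (2 * covector a y * ((hess (Λ x) y)⁻¹ l m * pd m (Λ x) y) -
        2 * Λ x y * ((hess (Λ x) y)⁻¹ l m * a m)) := fun m => by
    have h8 : ∑ k, y k * (c * (2 * a k * pd m (Λ x) y + pd k (fun x' => pd m (Λ x') y) x)) =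
        c * (2 * covector a y * pd m (Λ x) y + ∑ k, y k * pd k (fun x' => pd m (Λ x') y) x) := by
      rw [covector_apply, Finset.mul_sum, Finset.sum_mul, ← Finset.sum_add_distrib, Finset.mul_sum]
      exact Finset.sum_congr rfl fun k _ => by ring
    rw [h8]
    field_simp
    ring
  simp only [spray, ← hc, e1, e2, e4, Matrix.smul_apply, smul_eq_mul, e7, Finset.sum_add_distrib,
    Finset.sum_sub_distrib, ← Finset.mul_sum, e5, ← e6]
  ring

end IsSmoothEnergy
end Spray

/-! ### From vanishing third derivatives to `L = c⁻¹ E_*` -/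

section Fibre

variable {n : ℕ}

/-- A positively 2-homogeneous function with vanishing third derivatives off the origin is a
quadratic form. -/
lemma exists_form_of_pd_pd_pd_eq_zero (hn : 2 ≤ n) {q : Vec n → ℝ} (hq : ContDiffOn ℝ ∞ q {0}ᶜ)
    (hhom : ∀ (y : Vec n) (t : ℝ), 0 < t → q (t • y) = t ^ 2 * q y)
    (h3 : ∀ y, y ≠ 0 → ∀ i j k : Fin n, pd k (pd j (pd i q)) y = 0) :
    ∃ B : Vec n →L[ℝ] Vec n →L[ℝ] ℝ, (∀ u w, B u w = B w u) ∧ ∀ y, q y = 1 / 2 * B y y := by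
  have hS : IsOpen ({0}ᶜ : Set (Vec n)) := isOpen_compl_singleton
  have h : IsTwoHomogeneous q :=
    ⟨fun y hy => (hq.contDiffAt (hS.mem_nhds hy)).of_le (WithTop.coe_le_coe.2 le_top), hhom⟩
  -- Removing the origin leaves a connected set only because `n ≥ 2`; otherwise the Hessian could
  -- differ on the two half-lines.
  have hconn : IsPreconnected ({0}ᶜ : Set (Vec n)) := by
    refine (isConnected_compl_singleton_of_one_lt_rank ?_ 0).isPreconnected
    rw [← Module.finrank_eq_rank, finrank_euclideanSpace_fin]
    exact_mod_cast hn
  have hentry : ∀ i j : Fin n, ∀ y ∈ ({0}ᶜ : Set (Vec n)), ∀ z ∈ ({0}ᶜ : Set (Vec n)),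
      pd j (pd i q) y = pd j (pd i q) z := fun i j y hy z hz => by
    refine hS.is_const_of_fderiv_eq_zero (𝕜 := ℝ) hconn
      ((contDiffOn_pd hS (contDiffOn_pd hS hq i) j).differentiableOn (by simp)) ?_ hy hz
    intro x hx
    exact clm_ext_single fun k => by simpa [pd] using h3 x hx i j k
  obtain ⟨e₀, he₀⟩ : ∃ e₀ : Vec n, e₀ ≠ 0 := ⟨EuclideanSpace.single ⟨0, by omega⟩ 1, by simp⟩
  have hB : ∀ y, y ≠ 0 → fderiv ℝ (fderiv ℝ q) y = fderiv ℝ (fderiv ℝ q) e₀ := fun y hy => by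
    have hcol : ∀ j, fderiv ℝ (fderiv ℝ q) y (EuclideanSpace.single j 1) =
        fderiv ℝ (fderiv ℝ q) e₀ (EuclideanSpace.single j 1) := fun j => clm_ext_single fun i => by
      rw [← pd_pd_eq (h.differentiableAt_fderiv hy), ← pd_pd_eq (h.differentiableAt_fderiv he₀)]
      exact hentry i j y hy e₀ he₀
    ext u w
    have h1 := clm_apply_eq_sum ((fderiv ℝ (fderiv ℝ q) y).flip w) u
    have h2 := clm_apply_eq_sum ((fderiv ℝ (fderiv ℝ q) e₀).flip w) u
    simp only [ContinuousLinearMap.flip_apply, hcol] at h1 h2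
    rw [h1, h2]
  refine ⟨fderiv ℝ (fderiv ℝ q) e₀, h.hessian_comm he₀, fun y => ?_⟩
  rcases eq_or_ne y 0 with rfl | hy
  · simp [h.map_zero]
  · rw [← hB y hy, h.hessian_self_left hy, h.fderiv_self hy]
    ring

section Form

variable {B : Vec n →L[ℝ] Vec n →L[ℝ] ℝ} (hB : ∀ u w, B u w = B w u)
include hB

lemma fderiv_form : fderiv ℝ (fun y => 1 / 2 * B y y) = B := by
  funext y
  have e5 : HasFDerivAt (fun z => B z z)
      ((B y).comp (ContinuousLinearMap.id ℝ (Vec n)) + B.flip y) y :=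
    B.hasFDerivAt.clm_apply (hasFDerivAt_id y)
  rw [(e5.const_mul (1 / 2)).fderiv]
  ext w
  simp [hB w y]
  ring

lemma fderiv_fderiv_form (y : Vec n) : fderiv ℝ (fderiv ℝ fun y => 1 / 2 * B y y) y = B := by
  rw [fderiv_form hB]
  exact B.fderiv

lemma isMinkowskiEnergy_form (hpos : ∀ u, u ≠ 0 → 0 < B u u) :
    IsMinkowskiEnergy fun y => 1 / 2 * B y y where
  contDiffAt y _ := contDiffAt_const.mul
    (B.contDiff.contDiffAt.clm_apply contDiffAt_id)
  smul y t _ := by simp; ring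
  convex y w _ hw := by rw [fderiv_fderiv_form hB]; exact hpos w hw

end Form

/-- If the third derivatives of `E_*` vanish, then `E_*` is a quadratic form and `L` is a constant
multiple of it. -/
theorem exists_form_of_energyStar (hn : 2 ≤ n) {L : Vec n → ℝ} (hL : IsMinkowskiEnergy L)
    (hLs : ContDiffOn ℝ ∞ L {0}ᶜ) {a : Fin n → ℝ} (ha : covector a ≠ 0)
    (h3 : ∀ y, y ≠ 0 → ∀ i j k : Fin n,
      pd k (pd j (pd i fun y => covector a y * covector a y - energyStar L a y)) y = 0) :
    ∃ (B : Vec n →L[ℝ] Vec n →L[ℝ] ℝ) (Xs : Vec n) (c : ℝ), 0 < c ∧ (∀ u w, B u w = B w u) ∧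
      (∀ u, u ≠ 0 → 0 < B u u) ∧ (∀ y, energyStar L a y = 1 / 2 * B y y) ∧
      (∀ w, B Xs w = covector a w) ∧ covector a Xs = 1 ∧ (∀ y, L y = c⁻¹ * (1 / 2 * B y y)) ∧
      ∀ y, y ≠ 0 → gradStar L a y = Xs ∧ grad L a y = c • Xs := by
  have hu : ∀ y, y ≠ 0 → IsUnit (hess L y) := fun y hy => hL.isUnit_hess hy
  have hX : ContDiffOn ℝ ∞ (grad L a) {0}ᶜ := contDiffOn_grad hLs hu a
  have hgX : ∀ y, y ≠ 0 → fderiv ℝ (fderiv ℝ L) y (grad L a y) = covector a := fun y hy =>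
    hessian_grad (hL.differentiableAt_fderiv hy) (hu y hy) a
  have hXpos : ∀ y, y ≠ 0 → 0 < covector a (grad L a y) := fun y hy => by
    rw [← hgX y hy]
    refine hL.convex y _ hy fun h0 => ha ?_
    rw [← hgX y hy, h0, map_zero]
  have hXsmul : ∀ (y : Vec n) (t : ℝ), y ≠ 0 → 0 < t → grad L a (t • y) = grad L a y :=
    fun y t hy ht => by
    have hty : t • y ≠ 0 := smul_ne_zero ht.ne' hy
    refine grad_eq_of_hessian (hL.differentiableAt_fderiv hty) (hu _ hty) ?_
    -- Differentiating this degree-one homogeneity shows that the Hessian, hence the gradient, is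
    -- constant on rays.
    have h1 : (fun z => fderiv ℝ L (t • z)) = fun z => t • fderiv ℝ L z :=
      funext fun z => hL.fderiv_smul ht
    have h2 := fderiv_comp_smul (𝕜 := ℝ) (f := fderiv ℝ L) t (x := y)
    rw [h1, show fderiv ℝ (fun z => t • fderiv ℝ L z) y = t • fderiv ℝ (fderiv ℝ L) y from
      congrFun (fderiv_const_smul_field (𝕜 := ℝ) (f := fderiv ℝ L) t) y] at h2
    have h4 := congrArg (fun T : Vec n →L[ℝ] Vec n →L[ℝ] ℝ => T (grad L a y)) h2
    simp only [smul_apply] at h4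
    rw [← smul_right_injective _ ht.ne' h4, hgX y hy]
  have hstar : ContDiffOn ℝ ∞ (energyStar L a) {0}ᶜ := by
    have : energyStar L a = fun y => L y * covector a (grad L a y) :=
      funext fun y => energyStar_eq L a y
    rw [this]
    exact hLs.mul ((covector a).contDiff.comp_contDiffOn hX)
  obtain ⟨B₀, hB₀, hq⟩ := exists_form_of_pd_pd_pd_eq_zero hn
    ((((covector a).contDiff.mul (covector a).contDiff).contDiffOn).sub hstar)
    (fun y t ht => by
      rcases eq_or_ne y 0 with rfl | hy
      · simp [energyStar_eq, hL.map_zero]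
      · simp only [energyStar_eq, hXsmul y t hy ht, hL.smul y t ht, map_smul, smul_eq_mul]
        ring) h3
  -- Solves `α² - E_* = ½ B₀` for `E_* = ½ B`.
  let B : Vec n →L[ℝ] Vec n →L[ℝ] ℝ := (2 : ℝ) • (covector a).smulRight (covector a) - B₀
  have hBa : ∀ u w, B u w = 2 * (covector a u * covector a w) - B₀ u w := fun u w => by
    simp [B]
  have hB : ∀ u w, B u w = B w u := fun u w => by
    rw [hBa, hBa, hB₀ u w]; ring
  have hstarB : ∀ y, energyStar L a y = 1 / 2 * B y y := fun y => by
    rw [hBa]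
    linarith [hq y]
  have hBpos : ∀ u, u ≠ 0 → 0 < B u u := fun u hu => by
    have h1 := hstarB u
    rw [energyStar_eq] at h1
    have := mul_pos (hL.pos hu) (hXpos u hu)
    linarith
  have hQ := isMinkowskiEnergy_form hB hBpos
  obtain ⟨e₀, he₀⟩ : ∃ e₀ : Vec n, e₀ ≠ 0 := ⟨EuclideanSpace.single ⟨0, by omega⟩ 1, by simp⟩
  -- The Hessian of `½ B` is `B` everywhere, so any nonzero `e₀` gives the same vector.
  let Xs : Vec n := grad (fun y => 1 / 2 * B y y) a e₀
  have hXs : B Xs = covector a := by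
    have := hessian_grad (hQ.differentiableAt_fderiv he₀) (hQ.isUnit_hess he₀) a
    rwa [fderiv_fderiv_form hB] at this
  have hrig : HasQuadraticStar L (covector a) (grad L a) B Xs :=
    { toIsMinkowskiEnergy := hL
      differentiableAt_grad := fun y hy => (hX.contDiffAt
        (isOpen_compl_singleton.mem_nhds hy)).differentiableAt (by simp)
      hessian_grad := fun y u hy => by rw [hgX y hy]
      form_comm := hB
      form_pos := hBpos
      star_eq := fun y _ => by rw [← energyStar_eq, hstarB]
      form_gradStar := fun w => by rw [hXs]
      ne_zero := ha }
  let c := covector a (grad L a Xs)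
  have hc : 0 < c := hXpos Xs hrig.gradStar_ne_zero
  have hconst : ∀ y, y ≠ 0 → covector a (grad L a y) = c := fun y hy =>
    hrig.apply_grad_eq_const (by rw [finrank_euclideanSpace_fin]; omega) hy
  have hLQ : ∀ y, L y = c⁻¹ * (1 / 2 * B y y) := fun y => by
    rcases eq_or_ne y 0 with rfl | hy
    · simp [hL.map_zero]
    · rw [← hrig.star_eq y hy, hconst y hy]
      field_simp
  refine ⟨B, Xs, c, hc, hB, hBpos, hstarB, fun w => by rw [hXs], hrig.apply_gradStar_eq_one, hLQ,
    fun y hy => ⟨?_, ?_⟩⟩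
  · have : energyStar L a = fun y => 1 / 2 * B y y := funext hstarB
    rw [gradStar, this]
    refine grad_eq_of_hessian (hQ.differentiableAt_fderiv hy) (hQ.isUnit_hess hy) ?_
    rw [fderiv_fderiv_form hB, hXs]
  · refine grad_eq_of_hessian (hL.differentiableAt_fderiv hy) (hu y hy) ?_
    have h1 : fderiv ℝ L = fun y => c⁻¹ • B y := by
      have : L = c⁻¹ • fun y => 1 / 2 * B y y := funext hLQ
      rw [this, fderiv_const_smul_field, fderiv_form hB]
      rfl
    have h2 : fderiv ℝ (fderiv ℝ L) y = c⁻¹ • B := by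
      rw [h1]
      exact (c⁻¹ • B).fderiv
    rw [h2, map_smul, smul_apply, hXs, smul_smul, mul_inv_cancel₀ hc.ne', one_smul]

end Fibre

/-! ### Passage from the manifold to chart coordinates -/

lemma fderiv_fderiv_comp_equiv {V W : Type*} [NormedAddCommGroup V] [NormedSpace ℝ V]
    [NormedAddCommGroup W] [NormedSpace ℝ W] (T : V ≃L[ℝ] W) {f : W → ℝ} {v : V}
    (hf : DifferentiableAt ℝ (fderiv ℝ f) (T v)) (u w : V) :
    fderiv ℝ (fderiv ℝ (fun y => f (T y))) v u w = fderiv ℝ (fderiv ℝ f) (T v) (T u) (T w) := by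
  have h1 : fderiv ℝ (fun y => f (T y)) = fun y => (fderiv ℝ f (T y)).comp (T : V →L[ℝ] W) :=
    funext fun y => T.comp_right_fderiv (f := f)
  have h2 : HasFDerivAt (fun y => fderiv ℝ f (T y)) ((fderiv ℝ (fderiv ℝ f) (T v)).comp
      (T : V →L[ℝ] W)) v := hf.hasFDerivAt.comp v T.hasFDerivAt
  rw [h1, (h2.clm_comp (hasFDerivAt_const (T : V →L[ℝ] W) v)).fderiv]
  simp

section Manifold

variable {n : ℕ} {M : Type*} [TopologicalSpace M] [ChartedSpace (Vec n) M]
  {F : TangentBundle (𝓡 n) M → ℝ}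
  {e : OpenPartialHomeomorph M (Vec n)}

lemma mdifferentiable_of_mem_maximalAtlas (he : e ∈ IsManifold.maximalAtlas (𝓡 n) ∞ M) :
    e.MDifferentiable (𝓡 n) (𝓡 n) :=
  ⟨(contMDiffOn_of_mem_maximalAtlas he).mdifferentiableOn (by simp),
    (contMDiffOn_symm_of_mem_maximalAtlas he).mdifferentiableOn (by simp)⟩

lemma contMDiff_mk_tangentBundle :
    ContMDiff 𝓘(ℝ, Vec n × Vec n) (𝓡 n).tangent ∞
      (fun z : Vec n × Vec n => (⟨z.1, z.2⟩ : TangentBundle (𝓡 n) (Vec n))) := by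
  convert! contMDiff_tangentBundleModelSpaceHomeomorph_symm (I := 𝓡 n) (n := ∞) using 1
  exact modelWithCornersSelf_prod

/-- The inverse of the differential of a chart, as a linear automorphism of `ℝⁿ`. -/
noncomputable def symmDeriv (he : e ∈ IsManifold.maximalAtlas (𝓡 n) ∞ M) {x : Vec n}
    (hx : x ∈ e.target) : Vec n ≃L[ℝ] Vec n :=
  (mdifferentiable_of_mem_maximalAtlas he).symm.mfderiv hx

lemma coordEnergy_eq (he : e ∈ IsManifold.maximalAtlas (𝓡 n) ∞ M) {x : Vec n}
    (hx : x ∈ e.target) (y : Vec n) :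
    coordEnergy e F x y = energy F ⟨e.symm x, symmDeriv he hx y⟩ := rfl

/-- In coordinates `F` is composed with the tangent map of the inverse chart, which is smooth and,
being invertible on fibres, keeps nonzero vectors off the zero section. -/
lemma contDiffOn_coordEnergy [IsManifold (𝓡 n) ∞ M] (hF : IsFinslerMetric F)
    (he : e ∈ IsManifold.maximalAtlas (𝓡 n) ∞ M) :
    ContDiffOn ℝ ∞ (fun z : Vec n × Vec n => coordEnergy e F z.1 z.2) (e.target ×ˢ {0}ᶜ) := by
  have h1 := (contMDiffOn_symm_of_mem_maximalAtlas he).contMDiffOn_tangentMapWithin (m := ∞)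
    (by simp) e.open_target.uniqueMDiffOn
  have h2 : ContMDiffOn 𝓘(ℝ, Vec n × Vec n) (𝓡 n).tangent ∞
      (fun z : Vec n × Vec n => tangentMapWithin (𝓡 n) (𝓡 n) e.symm e.target
        (⟨z.1, z.2⟩ : TangentBundle (𝓡 n) (Vec n))) (e.target ×ˢ {0}ᶜ) :=
    h1.comp contMDiff_mk_tangentBundle.contMDiffOn fun z hz => hz.1
  have h3 : ContMDiffOn 𝓘(ℝ, Vec n × Vec n) (𝓡 n).tangent ∞
      (fun z : Vec n × Vec n => (⟨e.symm z.1, mfderiv (𝓡 n) (𝓡 n) e.symm z.1 z.2⟩ :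
        TangentBundle (𝓡 n) M)) (e.target ×ˢ {0}ᶜ) := by
    refine h2.congr fun z hz => ?_
    rw [tangentMapWithin, mfderivWithin_of_isOpen e.open_target hz.1]
  have h4 : ContMDiffOn 𝓘(ℝ, Vec n × Vec n) 𝓘(ℝ, ℝ) ∞
      (fun z : Vec n × Vec n => F ⟨e.symm z.1, mfderiv (𝓡 n) (𝓡 n) e.symm z.1 z.2⟩)
      (e.target ×ˢ {0}ᶜ) :=
    hF.smooth.comp h3 fun z hz => by
      have := (symmDeriv he hz.1).map_ne_zero_iff.2 (show z.2 ≠ 0 from hz.2)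
      exact this
  exact contDiffOn_const.mul (h4.contDiffOn.pow 2)

lemma isSmoothEnergy_coordEnergy [IsManifold (𝓡 n) ∞ M] (hF : IsFinslerMetric F)
    (he : e ∈ IsManifold.maximalAtlas (𝓡 n) ∞ M) :
    IsSmoothEnergy (coordEnergy e F) e.target :=
  ⟨e.open_target, contDiffOn_coordEnergy hF he⟩

lemma isMinkowskiEnergy_coordEnergy [IsManifold (𝓡 n) ∞ M] (hF : IsFinslerMetric F)
    (he : e ∈ IsManifold.maximalAtlas (𝓡 n) ∞ M) {x : Vec n} (hx : x ∈ e.target) :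
    IsMinkowskiEnergy (coordEnergy e F x) := by
  have hs : ContDiffOn ℝ ∞ (coordEnergy e F x) {0}ᶜ :=
    contDiffOn_slice (contDiffOn_coordEnergy hF he) hx
  have h2 : IsTwoHomogeneous (coordEnergy e F x) := by
    refine ⟨fun y hy => (hs.contDiffAt (isOpen_compl_singleton.mem_nhds hy)).of_le
      (WithTop.coe_le_coe.2 le_top), fun y t ht => ?_⟩
    have := hF.homogeneous (e.symm x) (symmDeriv he hx y) t ht
    rw [coordEnergy_eq he hx, coordEnergy_eq he hx, map_smul, energy, energy]
    erw [this]
    ring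
  refine ⟨h2, fun y w hy hw => ?_⟩
  set T := symmDeriv he hx with hT
  -- Convexity is given in the fixed identification of the tangent space with `ℝⁿ`; the linear
  -- isomorphism `T` carries it to chart coordinates.
  have h3 := hF.convex (e.symm x) (T y) (T w) (T.map_ne_zero_iff.2 hy) (T.map_ne_zero_iff.2 hw)
  have h4 : (fun z : Vec n => energy F ⟨e.symm x, z⟩) =
      fun z => coordEnergy e F x (T.symm z) := funext fun z => by
    rw [coordEnergy_eq he hx, ← hT, T.apply_symm_apply]
  rw [h4, fderiv_fderiv_comp_equiv T.symm
    (by rw [T.symm_apply_apply]; exact h2.differentiableAt_fderiv hy)] at h3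
  simpa using h3

lemma coordEnergy_conformalChange (α : M → ℝ) :
    coordEnergy e (conformalChange α F) =
      fun x y => Real.exp (2 * α (e.symm x)) * coordEnergy e F x y := by
  funext x y
  simp only [coordEnergy, energy, conformalChange]
  rw [mul_comm 2, Real.exp_mul]
  norm_cast
  ring

/-- The differential of a chart at `p`, as a linear isomorphism. -/
noncomputable def chartDeriv (he : e ∈ IsManifold.maximalAtlas (𝓡 n) ∞ M) {p : M}
    (hp : p ∈ e.source) : TangentSpace (𝓡 n) p ≃L[ℝ] Vec n :=
  (mdifferentiable_of_mem_maximalAtlas he).mfderiv hp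

lemma tangentCoord_eq (he : e ∈ IsManifold.maximalAtlas (𝓡 n) ∞ M) {p : M}
    (hp : p ∈ e.source) (v : TangentSpace (𝓡 n) p) : tangentCoord e p v = chartDeriv he hp v := rfl

/-- Needed because `e.symm (e p)` equals `p` only propositionally, while both fibres are `ℝⁿ` by
definition. -/
lemma tangentBundle_mk_eq {p q : M} (hq : q = p) {w v : Vec n} (h : w = v) :
    (⟨q, w⟩ : TangentBundle (𝓡 n) M) = ⟨p, v⟩ := by
  subst hq h; rfl

lemma energy_eq_coordEnergy (he : e ∈ IsManifold.maximalAtlas (𝓡 n) ∞ M) {p : M}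
    (hp : p ∈ e.source) (v : TangentSpace (𝓡 n) p) :
    energy F ⟨p, v⟩ = coordEnergy e F (e p) (tangentCoord e p v) := by
  refine congrArg (energy F) (tangentBundle_mk_eq (e.left_inv hp) ?_).symm
  exact congrArg (fun T => T v) ((mdifferentiable_of_mem_maximalAtlas he).symm_comp_deriv hp)

lemma differentiableAt_comp_symm (he : e ∈ IsManifold.maximalAtlas (𝓡 n) ∞ M) {p : M}
    (hp : p ∈ e.source) {α : M → ℝ} (hα : ContMDiff (𝓡 n) 𝓘(ℝ, ℝ) ∞ α) :
    DifferentiableAt ℝ (fun x => α (e.symm x)) (e p) := by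
  have h1 := (contMDiffOn_symm_of_mem_maximalAtlas he).contMDiffAt
    (e.open_target.mem_nhds (e.map_source hp))
  exact (hα.contMDiffAt.comp (e p) h1).contDiffAt.differentiableAt (by simp)

lemma covector_coordDeriv (he : e ∈ IsManifold.maximalAtlas (𝓡 n) ∞ M) {p : M}
    (hp : p ∈ e.source) {α : M → ℝ} (hα : ContMDiff (𝓡 n) 𝓘(ℝ, ℝ) ∞ α)
    (v : TangentSpace (𝓡 n) p) :
    covector (coordDeriv e α p) (tangentCoord e p v) = mfderiv (𝓡 n) 𝓘(ℝ, ℝ) α p v := by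
  have hd := differentiableAt_comp_symm he hp hα
  have h1 : covector (coordDeriv e α p) = fderiv ℝ (fun x => α (e.symm x)) (e p) :=
    clm_ext_single fun i => by rw [covector_single]; rfl
  have h2 : mfderiv (𝓡 n) 𝓘(ℝ, ℝ) ((fun x => α (e.symm x)) ∘ e) p =
      (mfderiv (𝓡 n) 𝓘(ℝ, ℝ) (fun x => α (e.symm x)) (e p)).comp (mfderiv (𝓡 n) (𝓡 n) e p) :=
    mfderiv_comp p hd.mdifferentiableAt
      ((mdifferentiable_of_mem_maximalAtlas he).mdifferentiableAt hp)
  have h3 : ((fun x => α (e.symm x)) ∘ e) =ᶠ[𝓝 p] α := by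
    filter_upwards [e.open_source.mem_nhds hp] with q hq
    simp [e.left_inv hq]
  rw [← h3.mfderiv_eq, h2, h1, ← mfderiv_eq_fderiv]
  rfl

end Manifold

/-! ### Linear dependence, the differential equations and the conclusion -/

lemma not_linearIndependent_of_smul {n : ℕ} (c : ℝ) (u w : Vec n) :
    ¬ LinearIndependent ℝ ![c • u, u, w] := by
  intro h
  have := Fintype.linearIndependent_iff.1 h ![1, -c, 0] (by simp [Fin.sum_univ_three]) 0
  simp at this

lemma gramDet_eq_zero_of_smul {n : ℕ} (L : Vec n → ℝ) (y : Vec n) (c : ℝ) (u w : Vec n) :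
    gramDet L y ![c • u, u, w] = 0 := by
  have h : ∀ z : Vec n, ∑ i, ∑ j, hess L y i j * (c • u) i * z j =
      c * ∑ i, ∑ j, hess L y i j * u i * z j := fun z => by
    simp only [Finset.mul_sum]
    refine Finset.sum_congr rfl fun i _ => Finset.sum_congr rfl fun j _ => ?_
    simp
    ring
  rw [gramDet, Matrix.det_fin_three]
  simp only [Matrix.of_apply, Matrix.cons_val, h]
  ring

/-- The equations satisfied by a quadratic polynomial `(a2 + s²) / (2c)` and its logarithmic
derivative. -/
lemma riccati_of_quadratic {c a2 t : ℝ} {Y Z : ℝ → ℝ} (hc : c ≠ 0)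
    (hY : ∀ s, Y s = c⁻¹ * (1 / 2 * (a2 + s ^ 2))) (hZ : ∀ s, Z s = deriv Y s / Y s)
    (hpos : a2 + t ^ 2 ≠ 0) :
    ContDiffAt ℝ 2 Y t ∧ DifferentiableAt ℝ Z t ∧
      (a2 + t ^ 2 * 1 * (1 - 1)) * Y t * deriv (deriv Y) t
        - (1 / 2) * (a2 + t ^ 2 * 1) * deriv Y t ^ 2
        + 2 * t * 1 ^ 2 * Y t * deriv Y t - 2 * 1 ^ 2 * Y t ^ 2 = 0 ∧
      (a2 + t ^ 2 * 1 * (1 - 1)) * deriv Z t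
        + (1 / 2) * (a2 + t ^ 2 * 1 * (1 - 2 * 1)) * Z t ^ 2
        + 2 * t * 1 ^ 2 * Z t - 2 * 1 ^ 2 = 0 := by
  have hYf : Y = fun s => c⁻¹ * (1 / 2 * (a2 + s ^ 2)) := funext hY
  have hd : ∀ s, HasDerivAt Y (c⁻¹ * s) s := fun s => by
    rw [hYf]
    refine ((((hasDerivAt_pow 2 s).const_add a2).const_mul (1 / 2)).const_mul c⁻¹).congr_deriv ?_
    simp
  have hdY : deriv Y = fun s => c⁻¹ * s := funext fun s => (hd s).deriv
  have hddY : HasDerivAt (deriv Y) c⁻¹ t := by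
    rw [hdY]
    simpa using (hasDerivAt_id t).const_mul c⁻¹
  have hYt : Y t ≠ 0 := by
    rw [hY]
    have := inv_ne_zero hc
    positivity
  have hZf : Z = fun s => deriv Y s / Y s := funext hZ
  have hdZ : HasDerivAt Z ((c⁻¹ * Y t - deriv Y t * (c⁻¹ * t)) / Y t ^ 2) t := by
    rw [hZf]
    exact hddY.div (hd t) hYt
  refine ⟨?_, hdZ.differentiableAt, ?_, ?_⟩
  · rw [hYf]
    fun_prop
  · rw [hddY.deriv, hdY, hY]
    ring
  · rw [hdZ.deriv, hZ, hdY, hY]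
    field_simp
    ring

/-- The invariance of the contracted mixed curvature, in terms of the third derivatives of
`E_*`. -/
lemma pd_pd_pd_energyStar {n : ℕ} {M : Type*} [TopologicalSpace M] [ChartedSpace (Vec n) M]
    [IsManifold (𝓡 n) ∞ M] {F : TangentBundle (𝓡 n) M → ℝ} (hF : IsFinslerMetric F)
    {α : M → ℝ} (hα : ContMDiff (𝓡 n) 𝓘(ℝ, ℝ) ∞ α) {p : M}
    {e : OpenPartialHomeomorph M (Vec n)} (he : e ∈ IsManifold.maximalAtlas (𝓡 n) ∞ M)
    (hpe : p ∈ e.source) {a : Fin n → ℝ} (ha : a = coordDeriv e α p)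
    {L : Vec n → ℝ} (hL : L = coordEnergy e F (e p))
    (hP : ∀ y : Vec n, y ≠ 0 → ∀ i j k : Fin n,
      ∑ l, berwaldMixed (coordEnergy e (conformalChange α F)) l i j k (e p) y * a l =
        ∑ l, berwaldMixed (coordEnergy e F) l i j k (e p) y * a l)
    (y : Vec n) (hy : y ≠ 0) (i j k : Fin n) :
    pd k (pd j (pd i fun y => covector a y * covector a y - energyStar L a y)) y = 0 := by
  have hx : e p ∈ e.target := e.map_source hpe
  have hS : IsOpen ({0}ᶜ : Set (Vec n)) := isOpen_compl_singleton
  have hsm := isSmoothEnergy_coordEnergy hF he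
  have hmink := isMinkowskiEnergy_coordEnergy hF he hx
  have hA := differentiableAt_comp_symm he hpe hα
  have hLs : ContDiffOn ℝ ∞ (coordEnergy e F (e p)) {0}ᶜ := contDiffOn_slice hsm.contDiffOn hx
  have hu : ∀ y, y ≠ 0 → IsUnit (hess (coordEnergy e F (e p)) y) := fun y hy => hmink.isUnit_hess hy
  have ha' : a = fun l => pd l (fun x => α (e.symm x)) (e p) := ha
  have hconf : ∀ l, Set.EqOn (spray (coordEnergy e (conformalChange α F)) l (e p))
      (fun y => spray (coordEnergy e F) l (e p) y + (covector a y * y l - L y * grad L a y l))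
      {0}ᶜ := fun l y hy => by
    rw [coordEnergy_conformalChange, hL, ha']
    exact hsm.spray_conformal hx hmink hy hA l
  have hsp : ∀ l, ContDiffOn ℝ ∞ (spray (coordEnergy e F) l (e p)) {0}ᶜ := fun l =>
    hsm.contDiffOn_spray hx hu l
  have hgr := contDiffOn_grad hLs hu a
  rw [← hL] at hLs hgr
  have hsp' : ∀ l, ContDiffOn ℝ ∞ (spray (coordEnergy e (conformalChange α F)) l (e p)) {0}ᶜ :=
    fun l => by
    refine ContDiffOn.congr ?_ (hconf l)
    have h1 : ContDiffOn ℝ ∞ (fun y : Vec n => y l) {0}ᶜ := by fun_prop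
    exact (hsp l).add (((covector a).contDiff.contDiffOn.mul h1).sub
      (hLs.mul (contDiffOn_euclidean.1 hgr l)))
  have hsum := ContDiffOn.sum (s := Finset.univ) fun l _ => (hsp l).mul
    (contDiffOn_const (c := a l))
  have hsum' := ContDiffOn.sum (s := Finset.univ) fun l _ => (hsp' l).mul
    (contDiffOn_const (c := a l))
  -- Contracting `α(y) yˡ - L Xˡ` with `αₗ` gives `α(y)² - E_*`.
  have heq : Set.EqOn (fun y => covector a y * covector a y - energyStar L a y)
      (fun y => ∑ l, spray (coordEnergy e (conformalChange α F)) l (e p) y * a l -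
        ∑ l, spray (coordEnergy e F) l (e p) y * a l) {0}ᶜ := fun y hy => by
    have h1 : ∑ l, spray (coordEnergy e (conformalChange α F)) l (e p) y * a l =
        ∑ l, (spray (coordEnergy e F) l (e p) y +
          (covector a y * y l - L y * grad L a y l)) * a l :=
      Finset.sum_congr rfl fun l _ => by rw [hconf l hy]
    simp only [h1, add_mul, sub_mul, mul_assoc, Finset.sum_add_distrib, Finset.sum_sub_distrib,
      ← Finset.mul_sum, ← covector_apply, energyStar]
    ring
  refine (pd_congr hS (pd_congr hS (pd_congr hS heq i) j) k hy).trans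
    ((pd_pd_pd_sub hS hsum' hsum i j k hy).trans ?_)
  have h1 := pd_pd_pd_sum hS hsp' a i j k hy
  have h2 := pd_pd_pd_sum hS hsp a i j k hy
  have h3 := hP y hy i j k
  simp only [berwaldMixed, neg_mul, Finset.sum_neg_distrib, neg_inj] at h3
  exact sub_eq_zero.2 (h1.trans (h3.trans h2.symm))

end FinslerConformal

theorem theorem2 {n : ℕ} (hn : 3 ≤ n)
    {M : Type*} [TopologicalSpace M] [ChartedSpace (Vec n) M] [IsManifold (𝓡 n) ∞ M]
    (F : TangentBundle (𝓡 n) M → ℝ) (hF : IsFinslerMetric F)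
    (α : M → ℝ) (hα : ContMDiff (𝓡 n) 𝓘(ℝ, ℝ) ∞ α)
    (p : M) (hdα : mfderiv (𝓡 n) 𝓘(ℝ, ℝ) α p ≠ 0)
    -- local coordinates around `p`
    (e : OpenPartialHomeomorph M (Vec n)) (he : e ∈ IsManifold.maximalAtlas (𝓡 n) ∞ M)
    (hpe : p ∈ e.source)
    -- the components of `dα` at `p`, and the energy of the tangent space at `p`
    (a : Fin n → ℝ) (ha : a = coordDeriv e α p)
    (L : Vec n → ℝ) (hL : L = coordEnergy e F (e p))
    (hcurv : IndicatrixPositivelyCurved L)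
    (hP : ∀ y : Vec n, y ≠ 0 → ∀ i j k : Fin n,
      ∑ l, berwaldMixed (coordEnergy e (conformalChange α F)) l i j k (e p) y * a l =
        ∑ l, berwaldMixed (coordEnergy e F) l i j k (e p) y * a l) :
    -- `E_*` is a positive definite quadratic form on the tangent space
    (∃ Q : QuadraticForm ℝ (TangentSpace (𝓡 n) p), Q.PosDef ∧
      ∀ v : TangentSpace (𝓡 n) p, energyStar L a (tangentCoord e p v) = Q v) ∧
    -- `X_*` depends only on the position
    ∃ Xs : TangentSpace (𝓡 n) p,
      (∀ v : TangentSpace (𝓡 n) p, v ≠ 0 →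
        gradStar L a (tangentCoord e p v) = tangentCoord e p Xs) ∧
      -- `X`, `X_*` and `C` are linearly dependent, and their Gram determinant vanishes
      (∀ v : TangentSpace (𝓡 n) p, v ≠ 0 →
        ¬ LinearIndependent ℝ
            ![grad L a (tangentCoord e p v), gradStar L a (tangentCoord e p v),
              tangentCoord e p v] ∧
        gramDet L (tangentCoord e p v)
            ![grad L a (tangentCoord e p v), gradStar L a (tangentCoord e p v),
              tangentCoord e p v] = 0) ∧
      -- the differential equation of the energy along `c(t) = v + t X_*`, and its Riccati form
      (∀ v : TangentSpace (𝓡 n) p, mfderiv (𝓡 n) 𝓘(ℝ, ℝ) α p v = 0 →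
        ∀ (a2 b2 : ℝ) (Y Z : ℝ → ℝ),
          a2 = 2 * energyStar L a (tangentCoord e p v) →
          b2 = 2 * energyStar L a (tangentCoord e p Xs) →
          (∀ t, Y t = energy F ⟨p, v + t • Xs⟩) →
          (∀ t, Z t = deriv Y t / Y t) →
          ∀ t : ℝ, (v ≠ 0 ∨ t ≠ 0) →
            v + t • Xs ≠ 0 ∧ 0 < Y t ∧ ContDiffAt ℝ 2 Y t ∧ DifferentiableAt ℝ Z t ∧
            (a2 + t ^ 2 * b2 * (1 - b2)) * Y t * deriv (deriv Y) t
              - (1 / 2) * (a2 + t ^ 2 * b2) * deriv Y t ^ 2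
              + 2 * t * b2 ^ 2 * Y t * deriv Y t - 2 * b2 ^ 2 * Y t ^ 2 = 0 ∧
            (a2 + t ^ 2 * b2 * (1 - b2)) * deriv Z t
              + (1 / 2) * (a2 + t ^ 2 * b2 * (1 - 2 * b2)) * Z t ^ 2
              + 2 * t * b2 ^ 2 * Z t - 2 * b2 ^ 2 = 0) := by
  have hx : e p ∈ e.target := e.map_source hpe
  have hcov := covector_coordDeriv he hpe hα
  rw [← ha] at hcov
  have hmink : IsMinkowskiEnergy L := hL ▸ isMinkowskiEnergy_coordEnergy hF he hx
  have hLs : ContDiffOn ℝ ∞ L {0}ᶜ := hL ▸ contDiffOn_slice (contDiffOn_coordEnergy hF he) hx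
  have ha0 : covector a ≠ 0 := fun h0 => hdα <| ContinuousLinearMap.ext fun v => by
    rw [← hcov v, h0]; rfl
  obtain ⟨B, Xs, c, hc, hB, hBpos, hstar, hXs, hone, hLB, hgrad⟩ :=
    exists_form_of_energyStar (by omega) hmink hLs ha0
      (pd_pd_pd_energyStar hF hα he hpe ha hL hP)
  set T := chartDeriv he hpe with hT
  have hTc : ∀ v : TangentSpace (𝓡 n) p, tangentCoord e p v = T v := tangentCoord_eq he hpe
  have hTXs : T (T.symm Xs) = Xs := T.apply_symm_apply Xs
  refine ⟨⟨(1 / 2 : ℝ) • (LinearMap.BilinMap.toQuadraticMap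
      (B.toLinearMap₁₂)).comp (T.toLinearEquiv : TangentSpace (𝓡 n) p →ₗ[ℝ] Vec n), ?_, ?_⟩,
    T.symm Xs, ?_, ?_, ?_⟩
  · intro v hv
    have := hBpos (T v) (T.map_ne_zero_iff.2 hv)
    simpa using this
  · intro v
    rw [hTc, hstar]
    simp
  · intro v hv
    rw [hTc, hTc, hTXs]
    exact (hgrad _ (T.map_ne_zero_iff.2 hv)).1
  · intro v hv
    obtain ⟨h1, h2⟩ := hgrad (T v) (T.map_ne_zero_iff.2 hv)
    rw [hTc, h1, h2]
    exact ⟨not_linearIndependent_of_smul c Xs _, gramDet_eq_zero_of_smul L _ c Xs _⟩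
  · intro v hv a2 b2 Y Z ha2 hb2 hY hZ t ht
    have hav : covector a (T v) = 0 := by rw [← hTc, hcov, hv]; rfl
    have hXsne : Xs ≠ 0 := by rintro rfl; simp at hone
    have hBv : B (T v) (T v) = a2 := by rw [ha2, hTc, hstar]; ring
    -- `b² = B(Xs, Xs) = α(Xs) = 1`.
    have hBX : b2 = 1 := by rw [hb2, hTc, hTXs, hstar, hXs, hone]; ring
    have hYt : ∀ s, Y s = c⁻¹ * (1 / 2 * (a2 + s ^ 2)) := fun s => by
      -- The condition `dα(v) = 0` makes `v` and `Xs` orthogonal for `B`, so `Y` has no linear term.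
      have h1 : B (T v) Xs = 0 := by rw [hB, hXs, hav]
      have h2 : B Xs (T v) = 0 := by rw [hXs, hav]
      rw [hY, energy_eq_coordEnergy he hpe, ← hL, hTc, hLB, map_add, map_smul, hTXs]
      simp only [map_add, map_smul, add_apply, smul_apply, smul_eq_mul, hBv, h1, h2, hXs, hone]
      ring
    have hpos : 0 < a2 + t ^ 2 := by
      rcases ht with hv0 | ht0
      · have := hBpos (T v) (T.map_ne_zero_iff.2 hv0)
        rw [hBv] at this
        positivity
      · have : 0 ≤ a2 := by
          rw [← hBv]
          rcases eq_or_ne (T v) 0 with h0 | h0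
          · simp [h0]
          · exact (hBpos _ h0).le
        positivity
    have hYpos : 0 < Y t := by rw [hYt]; positivity
    refine ⟨fun h0 => ?_, hYpos, ?_⟩
    · rw [hY, h0, energy_eq_coordEnergy he hpe, ← hL, hTc, map_zero, hmink.map_zero] at hYpos
      exact lt_irrefl _ hYpos
    -- The literals `1` in `riccati_of_quadratic` stand where `b2` stood.
    · subst hBX
      exact riccati_of_quadratic hc.ne' hYt hZ hpos.ne'
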